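/- Let $a\le b$, $m$, $D\ge 1$ be integers with $n=bm$ even, and let $k=am$. Consider $n$ qubits (the system $S$), arranged on a ring as $m$ consecutive blocks of $b$ qubits; the first $a$ qubits of each block are logical (register $L$, $k$ qubits), the other $b-a$ are ancillas. Let $R$ be a copy of $L$, let $|\hat\phi\rangle_{LR}$ be the maximally entangled state, and put $\rho_{SR}=|\hat\phi\rangle\langle\hat\phi|_{LR}\otimes|0\rangle\langle 0|^{\otimes(n-k)}_{S\setminus L}$. Let $\chi_{\mathrm{brick}}$ be the law of the brickwork circuit $U=U^{(s)}\cdots U^{(1)}$ with $D$ layers and $s=nD/2$ gates, where the gates are independent, uniformly distributed two-qubit Clifford gates (Clifford group modulo global phases). Odd layers act on the pairs $\{1,2\},\{3,4\},\dots,\{n-1,n\}$ and even layers on $\{2,3\},\{4,5\},\dots,\{n,1\}$, in this order; qubit labels are read modulo $n$. Let the noise be $\mathcal N=\mathcal N_1^{\otimes n}$, where $\mathcal N_1$ is one of the following: - Pauli noise $\mathcal N_1(\rho)=p_I\rho+p_XX\rho X+p_YY\rho Y+p_ZZ\rho Z$ with $p_I,p_X,p_Y,p_Z\ge 0$, $p_I+p_X+p_Y+p_Z=1$;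 put $f=2\log_2(\sqrt{p_I}+\sqrt{p_X}+\sqrt{p_Y}+\sqrt{p_Z})$; - erasure noise $\mathcal N_1(\rho)=(1-p)\rho+p\,\mathrm{tr}(\rho)|2\rangle\langle 2|$ with $p\in[0,1]$; put $f=\log_2(1+3p)$. Let $V:\mathcal H_S\to\mathcal H_{S'}\otimes\mathcal H_E$ be any Stinespring isometry of $\mathcal N$ with finite-dimensional environment $E$ (here $S'$ is the output system of $\mathcal N$), so $\mathcal N(\rho)=\mathrm{tr}_E(V\rho V^\dagger)$. Let $\hat{\mathcal N}(\rho)=\mathrm{tr}_{S'}(V\rho V^\dagger)$ be the complementary channel, $\tau_E=\hat{\mathcal N}(2^{-n}I_S)$, and $\tilde{\mathcal N}(\rho)=\tau_E^{-1/4}\hat{\mathcal N}(\rho)\tau_E^{-1/4}$, where $\tau_E^{-1/4}$ is taken on the support of $\tau_E$ and is $0$ on its kernel. Define the partition function $$Z=2^k\,\mathbb E_{U\sim\chi_{\mathrm{brick}}}\Big[\mathrm{tr}\Big(\big((\tilde{\mathcal N}\otimes\mathrm{id}_R)\big((U\otimes I_R)\rho_{SR}(U\otimes I_R)^\dagger\big)\big)^2\Big)\Big].$$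 For $\gamma,\nu\in\{I,S\}^n$ and $t\in\{1,\dots,s\}$, if $U^{(t)}$ acts on the qubits $\{x,x+1\}$, let $$M^{(t)}_{\nu\gamma}=\begin{cases}1,&\gamma_x=\gamma_{x+1}\text{ and }\gamma=\nu,\\ \tfrac25,&\gamma_x\ne\gamma_{x+1},\ \nu_x=\nu_{x+1}\text{ and }\gamma_y=\nu_y\text{ for all }y\notin\{x,x+1\},\\ 0,&\text{otherwise.}\end{cases}$$ Then, with $\lambda=2^{f-1}$ and $|\gamma|$ the number of entries of $\gamma$ equal to $S$, $$Z=3^k\,\frac{2^n}{3^n}\sum_{\substack{\vec\gamma=(\gamma^{(0)},\dots,\gamma^{(s)})\in(\{I,S\}^n)^{s+1}\\ \gamma^{(0)}\in(\{S\}^a\times\{I,S\}^{b-a})^m}}\lambda^{|\gamma^{(s)}|}\prod_{t=1}^sM^{(t)}_{\gamma^{(t)}\gamma^{(t-1)}}.$$ -/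

import Mathlib

open Matrix
open scoped BigOperators Kronecker

namespace QEC

noncomputable section

/-! ### Quantum channels, tensor powers, Stinespring dilations -/

/-- The linear map `ρ ↦ A ρ Aᴴ`. -/
def conjMap {α β : Type*} [Fintype α] (A : Matrix β α ℂ) :
    Matrix α α ℂ →ₗ[ℂ] Matrix β β ℂ where
  toFun ρ := A * ρ * Aᴴ
  map_add' x y := by simp [Matrix.mul_add, Matrix.add_mul]
  map_smul' c x := by simp

/-- The tensor power `Φ ^ ⊗n` of a linear map `Φ` between matrix algebras: the linear map that sends
`⨂ᵢ Aᵢ` to `⨂ᵢ Φ(Aᵢ)`, given by its values on the products of matrix units. -/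
def tensorPower {α β : Type*} [Fintype α] [DecidableEq α] (n : ℕ)
    (Φ : Matrix α α ℂ →ₗ[ℂ] Matrix β β ℂ) :
    Matrix (Fin n → α) (Fin n → α) ℂ →ₗ[ℂ] Matrix (Fin n → β) (Fin n → β) ℂ where
  toFun ρ := Matrix.of fun x y =>
    ∑ u, ∑ v, ρ u v * ∏ i, Φ (Matrix.single (u i) (v i) 1) (x i) (y i)
  map_add' ρ σ := by
    ext x y
    simp [add_mul, Finset.sum_add_distrib]
  map_smul' c ρ := by
    ext x y
    simp [mul_assoc, Finset.mul_sum]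

/-- The partial trace over the second tensor factor. -/
def ptraceSnd {α ε : Type*} [Fintype ε] (X : Matrix (α × ε) (α × ε) ℂ) : Matrix α α ℂ :=
  Matrix.of fun i j => ∑ e, X (i, e) (j, e)

/-- The partial trace over the first tensor factor. -/
def ptraceFst {α ε : Type*} [Fintype α] : Matrix (α × ε) (α × ε) ℂ →ₗ[ℂ] Matrix ε ε ℂ where
  toFun X := Matrix.of fun e e' => ∑ i, X (i, e) (i, e')
  map_add' X Y := by
    ext e e'
    simp [Finset.sum_add_distrib]
  map_smul' c X := by
    ext e e'
    simp [Finset.mul_sum]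

/-- `V : H_S → H_{S'} ⊗ H_E` is a Stinespring isometry of the channel `N` from `S` to `S'`:
`Vᴴ V = 1` and `N(ρ) = tr_E (V ρ Vᴴ)`. -/
structure IsStinespring {σ σ' ε : Type*} [Fintype σ] [DecidableEq σ] [Fintype σ'] [Fintype ε]
    (N : Matrix σ σ ℂ →ₗ[ℂ] Matrix σ' σ' ℂ) (V : Matrix (σ' × ε) σ ℂ) : Prop where
  isometry : Vᴴ * V = 1
  eq_ptrace : ∀ ρ : Matrix σ σ ℂ, N ρ = ptraceSnd (V * ρ * Vᴴ)

/-- The complementary channel `ρ ↦ tr_{S'} (V ρ Vᴴ)` from `S` to the environment `E`. -/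
def complementaryChannel {σ σ' ε : Type*} [Fintype σ] [Fintype σ']
    (V : Matrix (σ' × ε) σ ℂ) : Matrix σ σ ℂ →ₗ[ℂ] Matrix ε ε ℂ :=
  ptraceFst ∘ₗ conjMap V

/-- `τ_E = Φ(1 / dim S)`, the image of the maximally mixed state. -/
def tauState {σ ε : Type*} [Fintype σ] [DecidableEq σ]
    (Φ : Matrix σ σ ℂ →ₗ[ℂ] Matrix ε ε ℂ) : Matrix ε ε ℂ :=
  Φ ((Fintype.card σ : ℂ)⁻¹ • 1)

/-- `τ ^ (-1/4)` for a positive semidefinite `τ`, by functional calculus. The inverse is taken on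
the support of `τ` (the function `x ↦ x ^ (-1/4)` has the value `0` at `x = 0`). -/
def invFourthRoot {ε : Type*} [Fintype ε] [DecidableEq ε] (τ : Matrix ε ε ℂ) : Matrix ε ε ℂ :=
  cfc (fun x : ℝ => x ^ (-(1 / 4) : ℝ)) τ

/-- The normalized map `ρ ↦ τ_E ^ (-1/4) Φ(ρ) τ_E ^ (-1/4)` with `τ_E = Φ(1 / dim S)`. -/
def normalizedMap {σ ε : Type*} [Fintype σ] [DecidableEq σ] [Fintype ε] [DecidableEq ε]
    (Φ : Matrix σ σ ℂ →ₗ[ℂ] Matrix ε ε ℂ) : Matrix σ σ ℂ →ₗ[ℂ] Matrix ε ε ℂ :=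
  LinearMap.mulLeft ℂ (invFourthRoot (tauState Φ)) ∘ₗ
    LinearMap.mulRight ℂ (invFourthRoot (tauState Φ)) ∘ₗ Φ

/-- The extension `Φ ⊗ id_R` applied to a matrix on `S ⊗ R`, block by block. -/
def tensorId {σ ε r : Type*} (Φ : Matrix σ σ ℂ →ₗ[ℂ] Matrix ε ε ℂ)
    (X : Matrix (σ × r) (σ × r) ℂ) : Matrix (ε × r) (ε × r) ℂ :=
  Matrix.of fun p q => Φ (Matrix.of fun s s' => X (s, p.2) (s', q.2)) p.1 q.1

/-! ### Noise models -/

/-- The Pauli matrices `I, X, Y, Z`. -/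
def pauli : Fin 4 → Matrix (Fin 2) (Fin 2) ℂ
  | 0 => 1
  | 1 => !![0, 1; 1, 0]
  | 2 => !![0, -Complex.I; Complex.I, 0]
  | 3 => !![1, 0; 0, -1]

/-- Single-qubit Pauli noise `ρ ↦ p_I ρ + p_X XρX + p_Y YρY + p_Z ZρZ`. -/
def pauliNoise (p : Fin 4 → ℝ) : Matrix (Fin 2) (Fin 2) ℂ →ₗ[ℂ] Matrix (Fin 2) (Fin 2) ℂ :=
  ∑ j, (p j : ℂ) • conjMap (pauli j)

/-- The inclusion of a qubit, spanned by `|0⟩, |1⟩`, into a qutrit with the extra state `|2⟩`. -/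
def qubitInclusion : Matrix (Fin 3) (Fin 2) ℂ :=
  !![1, 0; 0, 1; 0, 0]

/-- Single-qubit erasure noise `ρ ↦ (1 - p) ρ + p tr(ρ) |2⟩⟨2|`. -/
def erasureNoise (p : ℝ) : Matrix (Fin 2) (Fin 2) ℂ →ₗ[ℂ] Matrix (Fin 3) (Fin 3) ℂ :=
  (1 - p : ℂ) • conjMap qubitInclusion +
    (p : ℂ) • (Matrix.traceLinearMap (Fin 2) ℂ ℂ).smulRight (Matrix.single (2 : Fin 3) 2 (1 : ℂ))

/-- The strength `f_P = 2 log₂ (√p_I + √p_X + √p_Y + √p_Z)` of Pauli noise. -/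
def pauliStrength (p : Fin 4 → ℝ) : ℝ :=
  2 * Real.logb 2 (∑ j, Real.sqrt (p j))

/-- The strength `f_e = log₂ (1 + 3p)` of erasure noise. -/
def erasureStrength (p : ℝ) : ℝ :=
  Real.logb 2 (1 + 3 * p)

/-! ### Two-qubit Clifford gates -/

/-- Two-qubit unitaries. -/
abbrev U4 : Type := Matrix.unitaryGroup (Fin 2 × Fin 2) ℂ

lemma pauli_mul (i j : Fin 4) : ∃ (c : ℕ) (k : Fin 4),
    pauli i * pauli j = (Complex.I ^ c) • pauli k := by
  fin_cases i <;> fin_cases j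
  · exact ⟨0, 0, by simp [pauli]⟩
  · exact ⟨0, 1, by simp [pauli]⟩
  · exact ⟨0, 2, by simp [pauli]⟩
  · exact ⟨0, 3, by simp [pauli]⟩
  · exact ⟨0, 1, by simp [pauli]⟩
  · exact ⟨0, 0, by ext a b; fin_cases a <;> fin_cases b <;> simp [pauli]⟩
  · exact ⟨1, 3, by ext a b; fin_cases a <;> fin_cases b <;> simp [pauli]⟩
  · exact ⟨3, 2, by ext a b; fin_cases a <;> fin_cases b <;> simp [pauli, Complex.I_pow_three]⟩
  · exact ⟨0, 2, by simp [pauli]⟩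
  · exact ⟨3, 3, by ext a b; fin_cases a <;> fin_cases b <;> simp [pauli, Complex.I_pow_three]⟩
  · exact ⟨0, 0, by ext a b; fin_cases a <;> fin_cases b <;> simp [pauli]⟩
  · exact ⟨1, 1, by ext a b; fin_cases a <;> fin_cases b <;> simp [pauli]⟩
  · exact ⟨0, 3, by simp [pauli]⟩
  · exact ⟨1, 2, by ext a b; fin_cases a <;> fin_cases b <;> simp [pauli]⟩
  · exact ⟨3, 1, by ext a b; fin_cases a <;> fin_cases b <;> simp [pauli, Complex.I_pow_three]⟩
  · exact ⟨0, 0, by ext a b; fin_cases a <;> fin_cases b <;> simp [pauli]⟩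

lemma pauli_conjTranspose (i : Fin 4) : (pauli i)ᴴ = pauli i := by
  fin_cases i <;> ext a b <;> fin_cases a <;> fin_cases b <;> simp [pauli]

lemma pauli_mul_self (i : Fin 4) : pauli i * pauli i = 1 := by
  fin_cases i <;> ext a b <;> fin_cases a <;> fin_cases b <;> simp [pauli]

/-- The two-qubit Pauli group: all `i ^ c P ⊗ Q` with `P, Q` Pauli matrices. -/
def pauliGroup : Subgroup U4 where
  carrier := {U | ∃ (c : ℕ) (i j : Fin 4),
    (U : Matrix (Fin 2 × Fin 2) (Fin 2 × Fin 2) ℂ) = (Complex.I ^ c) • (pauli i ⊗ₖ pauli j)}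
  mul_mem' := by
    rintro U V ⟨c, i, j, hU⟩ ⟨d, k, l, hV⟩
    obtain ⟨e, x, hx⟩ := pauli_mul i k
    obtain ⟨g, y, hy⟩ := pauli_mul j l
    refine ⟨c + d + e + g, x, y, ?_⟩
    rw [Matrix.UnitaryGroup.mul_val, hU, hV, Matrix.smul_mul, Matrix.mul_smul,
      ← Matrix.mul_kronecker_mul, hx, hy, Matrix.smul_kronecker, Matrix.kronecker_smul]
    simp only [smul_smul, pow_add]
    congr 1
    ring
  one_mem' := ⟨0, 0, 0, by simp [pauli]⟩
  inv_mem' := by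
    rintro U ⟨c, i, j, hU⟩
    refine ⟨3 * c, i, j, ?_⟩
    rw [Matrix.UnitaryGroup.inv_val, hU, Matrix.star_eq_conjTranspose, Matrix.conjTranspose_smul,
      Matrix.conjTranspose_kronecker, pauli_conjTranspose, pauli_conjTranspose, pow_mul,
      Complex.I_pow_three]
    simp

/-- The two-qubit Clifford group: the unitaries that normalize the Pauli group. -/
def cliffordGroup : Subgroup U4 :=
  Subgroup.normalizer (pauliGroup : Set U4)

/-- The global phases: the scalar unitaries. -/
def phases : Subgroup U4 where
  carrier := {U | ∃ c : ℂ, (U : Matrix (Fin 2 × Fin 2) (Fin 2 × Fin 2) ℂ) = c • 1}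
  mul_mem' := by
    rintro U V ⟨c, hU⟩ ⟨d, hV⟩
    exact ⟨c * d, by rw [Matrix.UnitaryGroup.mul_val, hU, hV]; simp [smul_smul, mul_comm]⟩
  one_mem' := ⟨1, by simp⟩
  inv_mem' := by
    rintro U ⟨c, hU⟩
    exact ⟨star c, by rw [Matrix.UnitaryGroup.inv_val, hU]; simp⟩

/-- A two-qubit Clifford gate: an element of the Clifford group up to a global phase. -/
abbrev CliffordGate : Type := cliffordGroup ⧸ phases.subgroupOf cliffordGroup

instance pauliGroup_finite : Finite pauliGroup := by
  have hfin : (Set.range fun q : Fin 4 × Fin 4 × Fin 4 =>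
      (Complex.I ^ (q.1 : ℕ)) • (pauli q.2.1 ⊗ₖ pauli q.2.2)).Finite := Set.finite_range _
  have hsub : Set.MapsTo (fun U : U4 => (U : Matrix (Fin 2 × Fin 2) (Fin 2 × Fin 2) ℂ))
      (pauliGroup : Set U4) (Set.range fun q : Fin 4 × Fin 4 × Fin 4 =>
      (Complex.I ^ (q.1 : ℕ)) • (pauli q.2.1 ⊗ₖ pauli q.2.2)) := by
    rintro U ⟨c, i, j, hU⟩
    refine ⟨(⟨c % 4, Nat.mod_lt _ (by norm_num)⟩, i, j), ?_⟩
    simp only [hU]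
    rw [Complex.I_pow_eq_pow_mod c]
  exact (Set.Finite.of_injOn hsub Subtype.val_injective.injOn hfin).to_subtype

lemma pauli_kronecker_mem_unitary (i j : Fin 4) :
    pauli i ⊗ₖ pauli j ∈ Matrix.unitaryGroup (Fin 2 × Fin 2) ℂ := by
  rw [Matrix.mem_unitaryGroup_iff, Matrix.star_eq_conjTranspose, Matrix.conjTranspose_kronecker,
    pauli_conjTranspose, pauli_conjTranspose, ← Matrix.mul_kronecker_mul, pauli_mul_self,
    pauli_mul_self, Matrix.one_kronecker_one]

lemma centralizer_pauliGroup_le : Subgroup.centralizer (pauliGroup : Set U4) ≤ phases := by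
  intro U hU
  rw [Subgroup.mem_centralizer_iff] at hU
  have key (i j : Fin 4) : (pauli i ⊗ₖ pauli j) * (U : Matrix (Fin 2 × Fin 2) (Fin 2 × Fin 2) ℂ) =
      (U : Matrix (Fin 2 × Fin 2) (Fin 2 × Fin 2) ℂ) * (pauli i ⊗ₖ pauli j) := by
    have := hU ⟨_, pauli_kronecker_mem_unitary i j⟩ ⟨0, i, j, by simp⟩
    exact congrArg Subtype.val this
  have hent (i j : Fin 4) (r s : Fin 2 × Fin 2) := congrFun (congrFun (key i j) r) s
  simp only [Matrix.mul_apply, Fintype.sum_prod_type, Fin.sum_univ_two,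
    Matrix.kroneckerMap_apply] at hent
  have hZ1 := hent 3 0
  have hZ2 := hent 0 3
  have hX1 := hent 1 0
  have hX2 := hent 0 1
  simp only [pauli, Prod.forall, Fin.forall_fin_two] at hZ1 hZ2 hX1 hX2
  simp [self_eq_neg, neg_eq_self] at hZ1 hZ2 hX1 hX2
  refine ⟨U.1 (0, 0) (0, 0), ?_⟩
  ext ⟨r1, r2⟩ ⟨s1, s2⟩
  fin_cases r1 <;> fin_cases r2 <;> fin_cases s1 <;> fin_cases s2 <;>
    simp <;> grind

instance cliffordGate_finite : Finite CliffordGate := by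
  have hle : (pauliGroup.normalizerMonoidHom).ker ≤ phases.subgroupOf cliffordGroup := by
    rw [Subgroup.normalizerMonoidHom_ker]
    exact Subgroup.comap_mono centralizer_pauliGroup_le
  have : Finite (MulAut pauliGroup) :=
    Finite.of_injective (fun e : MulAut pauliGroup => (e : pauliGroup → pauliGroup))
      DFunLike.coe_injective
  have h1 : (pauliGroup.normalizerMonoidHom).ker.FiniteIndex :=
    ⟨by rw [Subgroup.index_ker]; exact Nat.card_pos.ne'⟩
  have h2 : (phases.subgroupOf cliffordGroup).FiniteIndex := @Subgroup.finiteIndex_of_le _ _ _ _ h1 hle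
  exact Subgroup.finite_quotient_of_finiteIndex

instance cliffordGate_fintype : Fintype CliffordGate := Fintype.ofFinite _

/-- A unitary that implements a Clifford gate (which one is irrelevant: it only enters through
conjugation). -/
def CliffordGate.toMatrix (g : CliffordGate) : Matrix (Fin 2 × Fin 2) (Fin 2 × Fin 2) ℂ :=
  ((Quotient.out g : cliffordGroup) : U4)

/-! ### Brickwork circuits -/

/-- Computational basis labels of `n` qubits. -/
abbrev Qubits (n : ℕ) : Type := Fin n → Fin 2

/-- The two-qubit matrix `G` acting on the (distinct) qubits `x` and `y`, and as the identity on the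
other ones. -/
def onPair {n : ℕ} (x y : Fin n) (G : Matrix (Fin 2 × Fin 2) (Fin 2 × Fin 2) ℂ) :
    Matrix (Qubits n) (Qubits n) ℂ :=
  Matrix.of fun u v =>
    if ∀ z, z ≠ x → z ≠ y → u z = v z then G (u x, u y) (v x, v y) else 0

/-- The number `s = n D / 2` of gates of a brickwork circuit with `D` layers on `n` qubits
(`n` even). -/
def gateCount (n D : ℕ) : ℕ := n / 2 * D

lemma pos_of_gate {n D : ℕ} (t : Fin (gateCount n D)) : 0 < n := by
  rcases Nat.eq_zero_or_pos n with rfl | h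
  · exact absurd t.2 (by simp [gateCount])
  · exact h

/-- The first qubit `x` of the pair `{x, x + 1}` on which the gate number `t` acts. Qubits, gates
and layers are counted from `0`; gate `t` is the `j`-th one of layer `ℓ`, where
`t = ℓ (n / 2) + j` and `j < n / 2`, and `x = 2 j + (ℓ mod 2)`. -/
def leftQubit {n D : ℕ} (t : Fin (gateCount n D)) : Fin n :=
  ⟨(2 * (t % (n / 2)) + (t / (n / 2)) % 2) % n, Nat.mod_lt _ (pos_of_gate t)⟩

/-- The second qubit `x + 1` (modulo `n`: periodic boundary conditions) of gate number `t`. -/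
def rightQubit {n D : ℕ} (t : Fin (gateCount n D)) : Fin n :=
  ⟨((leftQubit t : ℕ) + 1) % n, Nat.mod_lt _ (pos_of_gate t)⟩

/-- The unitary `U⁽ˢ⁾ ⋯ U⁽²⁾ U⁽¹⁾` of a brickwork circuit with the gates `g`; gate number `0` is
applied first. -/
def circuit {n D : ℕ} (g : Fin (gateCount n D) → CliffordGate) : Matrix (Qubits n) (Qubits n) ℂ :=
  ((List.ofFn fun t => onPair (leftQubit t) (rightQubit t) (g t).toMatrix).reverse).prod

/-- The expectation of `F(U)` over a random brickwork circuit `U` on `n` qubits with `D` layers, the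
gates being independent and uniformly distributed two-qubit Clifford gates. -/
def brickworkExpect (n D : ℕ) (F : Matrix (Qubits n) (Qubits n) ℂ → ℂ) : ℂ :=
  (∑ g : Fin (gateCount n D) → CliffordGate, F (circuit g)) /
    (Fintype.card (Fin (gateCount n D) → CliffordGate) : ℂ)

/-! ### The encoded state and the partition function -/

/-- Qubit `i` is logical: the `n = b m` qubits form `m` consecutive blocks of size `b`, and the first
`a` qubits of each block are logical, the other `b - a` are ancillas. -/
def IsLogical (a b : ℕ) {n : ℕ} (i : Fin n) : Prop := (i : ℕ) % b < a

instance (a b n : ℕ) : DecidablePred (IsLogical a b (n := n)) :=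
  fun i => inferInstanceAs (Decidable ((i : ℕ) % b < a))

/-- Basis labels of the logical register `L`, and of its copy, the reference register `R`. -/
abbrev Logical (a b n : ℕ) : Type := {i : Fin n // IsLogical a b i} → Fin 2

/-- The maximally entangled state `|φ⟩⟨φ|` with `|φ⟩ = d ^ (-1/2) ∑ₓ |x⟩|x⟩`. -/
def maxEntangled (κ : Type*) [Fintype κ] [DecidableEq κ] : Matrix (κ × κ) (κ × κ) ℂ :=
  Matrix.of fun p q => if p.1 = p.2 ∧ q.1 = q.2 then (Fintype.card κ : ℂ)⁻¹ else 0

/-- `ρ_SR = |φ⟩⟨φ|_LR ⊗ |0⟩⟨0|_{S \ L}`. -/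
def initialState (a b n : ℕ) :
    Matrix (Qubits n × Logical a b n) (Qubits n × Logical a b n) ℂ :=
  Matrix.of fun p q =>
    maxEntangled (Logical a b n) ((fun i => p.1 i), p.2) ((fun i => q.1 i), q.2) *
      (if ∀ i, ¬ IsLogical a b i → p.1 i = 0 ∧ q.1 i = 0 then 1 else 0)

/-- The partition function
`Z = 2 ^ k E_U [tr ((Ñ(U ρ_SR Uᴴ))²)]` with `k = a m`, `n = b m`, where `Ñ` is the normalized
complementary channel that belongs to the Stinespring isometry `V`. -/
def partitionFunction (a b m D : ℕ) {σ' ε : Type*} [Fintype σ'] [Fintype ε] [DecidableEq ε]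
    (V : Matrix (σ' × ε) (Qubits (b * m)) ℂ) : ℂ :=
  2 ^ (a * m) * brickworkExpect (b * m) D fun U =>
    ((tensorId (normalizedMap (complementaryChannel V))
      (conjMap (U ⊗ₖ (1 : Matrix (Logical a b (b * m)) (Logical a b (b * m)) ℂ))
        (initialState a b (b * m)))) ^ 2).trace

/-! ### Configurations -/

/-- Configurations in `{I, S} ^ n`: `true` stands for `S` and `false` for `I`. -/
abbrev Config (n : ℕ) : Type := Fin n → Bool

/-- The transfer matrix entry `M_{ν γ}` of a gate on the qubits `x` and `y`. -/
def transfer {n : ℕ} (x y : Fin n) (ν γ : Config n) : ℝ :=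
  if γ x = γ y ∧ γ = ν then 1
  else if γ x ≠ γ y ∧ ν x = ν y ∧ ∀ z, z ≠ x → z ≠ y → γ z = ν z then 2 / 5
  else 0

/-- `|γ|`, the number of `S` factors. -/
def countS {n : ℕ} (γ : Config n) : ℕ := (Finset.univ.filter fun i => γ i = true).card

/-- The explicit sum over trajectories `γ⁽⁰⁾, …, γ⁽ˢ⁾` with
`γ⁽⁰⁾ ∈ ({S} ^ a × {I, S} ^ (b - a)) ^ m`. -/
def trajectorySum (a b m D : ℕ) (lam : ℝ) : ℝ :=
  ∑ γ : Fin (gateCount (b * m) D + 1) → Config (b * m) with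
      ∀ i, IsLogical a b i → γ 0 i = true,
    lam ^ countS (γ (Fin.last _)) *
      ∏ t : Fin (gateCount (b * m) D),
        transfer (leftQubit t) (rightQubit t) (γ t.succ) (γ t.castSucc)

end

end QEC

namespace QEC

noncomputable section

/-! ### The quadratic form of the normalized complementary channel -/

section Environment

open scoped MatrixOrder ComplexOrder

/-! The normalization by `τ_E ^ (-1/4)` makes `Z` independent of the dilation. Arrange the conjugate
Kraus operators of `V` as the columns of `W`. Then `Wᴴ W` is `τ_E` up to the factor `d = dim S`,
while `W Wᴴ` is the (conjugated) Choi matrix `C`, which depends on the channel alone. The matrix `W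
τ_E ^ (-1/2) Wᴴ` is positive and squares to `d C`, so it is `√d P` with `P = C ^ (1/2)`. Hence
tr(Ñ(A) Ñ(B)) = d tr(P (1 ⊗ A) P (1 ⊗ B)) (`trace_normalizedMap_mul`), a linear functional of `A ⊗
B`. For a tensor power channel `P` is a tensor power too, and the functional factorizes over the
qubits (`pairing_sitePower`).

On two copies, the purity of the initial state is carried by the swap `S` on logical qubits and by
`|00⟩⟨00|` on ancillas (`sum_block_initialState`). Each gate contributes the twirl over the Clifford
group, which is a unitary 2-design, so its output lies in the span of `I ⊗ I` and `S ⊗ S`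
(`twirl_eq`). Equal neighbours are fixed, and `I ⊗ S` becomes 2/5 (`I ⊗ I` + `S ⊗ S`): this is the
matrix `M`. Iterating it produces the sum over trajectories (`map_circuitChannel_siteOp`).

The twirl sees a site only through the traces against `I` and `S`. Every qubit meets a gate in the
first layer, so `|00⟩⟨00|` may be replaced by `(I + S)/6` (`circuitChannel_congr`,
`trace_initialSite`); this gives the free sum over the ancilla entries of `γ⁽⁰⁾`. At the end a site
contributes `2` for `I` and `2λ` for `S`. Only these two numbers depend on the noise; they follow
from explicit square roots of the two Choi matrices. -/

lemma eq_of_posSemidef_of_mul_self_eq {κ : Type*} [Fintype κ] [DecidableEq κ]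
    {A B : Matrix κ κ ℂ} (hA : A.PosSemidef) (hB : B.PosSemidef) (h : A * A = B * B) : A = B := by
  exact (CFC.sqrt_unique h hA.nonneg).symm.trans (CFC.sqrt_unique rfl hB.nonneg)

variable {σ σ' ε : Type*} [Fintype σ] [DecidableEq σ] [Fintype σ'] [DecidableEq σ']
  [Fintype ε] [DecidableEq ε]

/-- The conjugate Kraus operators of `V`, vectorized and arranged as columns. -/
def krausMatrix (V : Matrix (σ' × ε) σ ℂ) : Matrix (σ' × σ) ε ℂ :=
  Matrix.of fun p e => star (V (p.1, e) p.2)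

omit [DecidableEq σ] [DecidableEq ε] [Fintype ε] in
lemma complementaryChannel_eq (V : Matrix (σ' × ε) σ ℂ) (A : Matrix σ σ ℂ) :
    complementaryChannel V A =
      (krausMatrix V)ᴴ * ((1 : Matrix σ' σ' ℂ) ⊗ₖ A) * krausMatrix V := by
  ext e e'
  simp [complementaryChannel, ptraceFst, conjMap, krausMatrix, Matrix.mul_apply,
    Fintype.sum_prod_type, Matrix.one_apply]

/-- The Choi matrix of a linear map, complex conjugated. -/
def choi (N : Matrix σ σ ℂ →ₗ[ℂ] Matrix σ' σ' ℂ) : Matrix (σ' × σ) (σ' × σ) ℂ :=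
  Matrix.of fun p q => N (Matrix.single q.2 p.2 1) q.1 p.1

omit [DecidableEq σ'] [DecidableEq ε] in
-- The product in this order traces out the environment, so nothing of `V` survives except the
-- channel. This is why any Stinespring isometry gives the same `Z`.
lemma IsStinespring.krausMatrix_mul_conjTranspose {N : Matrix σ σ ℂ →ₗ[ℂ] Matrix σ' σ' ℂ}
    {V : Matrix (σ' × ε) σ ℂ} (hV : IsStinespring N V) :
    krausMatrix V * (krausMatrix V)ᴴ = choi N := by
  ext ⟨i, s⟩ ⟨j, t⟩
  simp [choi, hV.eq_ptrace, ptraceSnd, krausMatrix, Matrix.mul_apply, Matrix.single_apply,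
    ite_and, mul_comm]

/-- `Wᴴ W` and `W` have the same kernel: for the spectral projection `k` onto that kernel, `(W k)ᴴ
(W k) = 0`, so `W k = 0`. -/
lemma mul_cfc_support {κ : Type*} [Fintype κ] [DecidableEq κ] (W : Matrix κ ε ℂ) {c : ℝ}
    (hc : c ≠ 0) :
    W * cfc (fun x : ℝ => if x = 0 then 0 else 1) (c • (Wᴴ * W)) = W := by
  have hfin : ∀ f : ℝ → ℝ, ContinuousOn f (spectrum ℝ (c • (Wᴴ * W))) := fun f =>
    Matrix.finite_real_spectrum.continuousOn f
  have hsa : IsSelfAdjoint (c • (Wᴴ * W)) :=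
    IsSelfAdjoint.smul (IsSelfAdjoint.all c) (Matrix.isHermitian_conjTranspose_mul_self W)
  set T := c • (Wᴴ * W) with hT
  set k := cfc (fun x : ℝ => if x = 0 then (1 : ℝ) else 0) T with hk
  have hsum : cfc (fun x : ℝ => if x = 0 then (0 : ℝ) else 1) T + k = 1 := by
    rw [hk, ← cfc_add _ _ _ (hfin _) (hfin _)]
    rw [← cfc_one ℝ T]
    refine cfc_congr fun x _ => ?_
    by_cases h : x = 0 <;> simp [h]
  have hTk : T * k = 0 := by
    have h1 : cfc (fun x : ℝ => x) T = T := cfc_id ℝ T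
    calc T * k = cfc (fun x : ℝ => x) T * k := by rw [h1]
      _ = 0 := by
        rw [hk, ← cfc_mul _ _ _ (hfin _) (hfin _), ← cfc_zero ℝ T]
        refine cfc_congr fun x _ => ?_
        by_cases h : x = 0 <;> simp [h]
  have hWk : W * k = 0 := by
    rw [← Matrix.conjTranspose_mul_self_eq_zero, Matrix.conjTranspose_mul]
    have h2 : (Wᴴ * W) * k = 0 := by
      rw [hT, Matrix.smul_mul] at hTk
      exact (smul_eq_zero.mp hTk).resolve_left hc
    rw [Matrix.mul_assoc, ← Matrix.mul_assoc Wᴴ, h2, Matrix.mul_zero]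
  have := congrArg (W * ·) hsum
  simpa [Matrix.mul_add, hWk] using this

lemma trace_normalizedMap_mul [Nonempty σ] {N : Matrix σ σ ℂ →ₗ[ℂ] Matrix σ' σ' ℂ}
    {V : Matrix (σ' × ε) σ ℂ} (hV : IsStinespring N V) {P : Matrix (σ' × σ) (σ' × σ) ℂ}
    (hP : P.PosSemidef) (hPN : P * P = choi N) (A B : Matrix σ σ ℂ) :
    (normalizedMap (complementaryChannel V) A * normalizedMap (complementaryChannel V) B).trace =
      Fintype.card σ * (P * ((1 : Matrix σ' σ' ℂ) ⊗ₖ A) * P *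
        ((1 : Matrix σ' σ' ℂ) ⊗ₖ B)).trace := by
  set d : ℝ := (Fintype.card σ : ℝ) with hd
  have hd0 : 0 < d := by rw [hd]; exact_mod_cast Fintype.card_pos
  set W := krausMatrix V with hW
  have hτ : tauState (complementaryChannel V) = d⁻¹ • (Wᴴ * W) := by
    rw [tauState, complementaryChannel_eq, Matrix.kronecker_smul, Matrix.one_kronecker_one,
      Matrix.mul_smul, Matrix.mul_one, Matrix.smul_mul, hd, ← hW]
    ext i j
    simp
  set τ := tauState (complementaryChannel V) with hτd
  have hτps : τ.PosSemidef := by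
    rw [hτ]
    exact (Matrix.posSemidef_conjTranspose_mul_self W).smul (by positivity)
  have hfin : ∀ f : ℝ → ℝ, ContinuousOn f (spectrum ℝ τ) := fun f =>
    Matrix.finite_real_spectrum.continuousOn f
  set R := invFourthRoot τ with hR
  have hRh : Rᴴ = R := by
    have : IsSelfAdjoint R := cfc_predicate _ _
    exact this
  have hWW : Wᴴ * W = d • τ := by rw [hτ, smul_smul, mul_inv_cancel₀ hd0.ne', one_smul]
  have hproj : R * R * τ * (R * R) = cfc (fun x : ℝ => if x = 0 then 0 else 1) τ := by
    have h1 : cfc (fun x : ℝ => x) τ = τ := cfc_id ℝ τ hτps.1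
    conv_lhs => rw [← h1]
    rw [hR, invFourthRoot, ← cfc_mul _ _ _ (hfin _) (hfin _), ← cfc_mul _ _ _ (hfin _) (hfin _),
      ← cfc_mul _ _ _ (hfin _) (hfin _)]
    refine cfc_congr fun x hx => ?_
    have hx0 : 0 ≤ x := spectrum_nonneg_of_nonneg hτps.nonneg hx
    rcases hx0.eq_or_lt with rfl | hx0
    · simp
    · have h2 : x ^ (-(1 / 4) : ℝ) * x ^ (-(1 / 4) : ℝ) = x ^ (-(1 / 2) : ℝ) := by
        rw [← Real.rpow_add hx0]; norm_num
      have h3 : x ^ (-(1 / 2) : ℝ) * x * x ^ (-(1 / 2) : ℝ) = 1 := by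
        nth_rw 2 [← Real.rpow_one x]
        rw [← Real.rpow_add hx0, ← Real.rpow_add hx0]; norm_num
      simp only [h2, h3, hx0.ne', if_false]
  have hWp : W * cfc (fun x : ℝ => if x = 0 then 0 else 1) τ = W := by
    rw [hτ]
    exact mul_cfc_support W (inv_ne_zero hd0.ne')
  -- Both sides are positive semidefinite with square `d W Wᴴ`: on the left, `R² τ R²` is the
  -- support projection of `τ`, which `W` absorbs.
  have hM : W * (R * R) * Wᴴ = Real.sqrt d • P := by
    refine eq_of_posSemidef_of_mul_self_eq ?_ (hP.smul (Real.sqrt_nonneg d)) ?_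
    · have := Matrix.posSemidef_self_mul_conjTranspose (W * R)
      rwa [Matrix.conjTranspose_mul, hRh, ← Matrix.mul_assoc, Matrix.mul_assoc W R R] at this
    · calc W * (R * R) * Wᴴ * (W * (R * R) * Wᴴ) = W * (R * R * (Wᴴ * W) * (R * R)) * Wᴴ := by
            simp only [Matrix.mul_assoc]
        _ = d • (W * Wᴴ) := by
            rw [hWW, Matrix.mul_smul, Matrix.smul_mul, hproj, Matrix.mul_smul, hWp, Matrix.smul_mul]
        _ = _ := by
            rw [hV.krausMatrix_mul_conjTranspose, ← hPN, Matrix.smul_mul, Matrix.mul_smul, smul_smul,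
              Real.mul_self_sqrt hd0.le]
  have hn (X : Matrix σ σ ℂ) : normalizedMap (complementaryChannel V) X =
      R * (Wᴴ * ((1 : Matrix σ' σ' ℂ) ⊗ₖ X) * W * R) := by
    simp only [normalizedMap, LinearMap.comp_apply, LinearMap.mulLeft_apply,
      LinearMap.mulRight_apply, complementaryChannel_eq, hR, hτd, hW]
  rw [hn, hn]
  set KA := (1 : Matrix σ' σ' ℂ) ⊗ₖ A
  set KB := (1 : Matrix σ' σ' ℂ) ⊗ₖ B
  calc _ = (R * (Wᴴ * KA * (W * (R * R) * Wᴴ) * KB * W * R)).trace := by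
        simp only [Matrix.mul_assoc]
    _ = ((W * (R * R) * Wᴴ) * KA * (W * (R * R) * Wᴴ) * KB).trace := by
        rw [Matrix.trace_mul_comm, Matrix.mul_assoc _ R R, Matrix.mul_assoc _ W (R * R),
          Matrix.trace_mul_comm]
        simp only [Matrix.mul_assoc]
    _ = _ := by
        rw [hM]
        simp only [Matrix.smul_mul, Matrix.mul_smul, smul_smul, Real.mul_self_sqrt hd0.le,
          Matrix.trace_smul]
        rw [hd]
        simp

end Environment

/-! ### Products over sites -/

/-- The `n`-th tensor power of a matrix on a pair of systems, with the `n` copies of either system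
grouped together. -/
def sitePower {α β : Type*} (n : ℕ) (P : Matrix (β × α) (β × α) ℂ) :
    Matrix ((Fin n → β) × (Fin n → α)) ((Fin n → β) × (Fin n → α)) ℂ :=
  Matrix.of fun p q => ∏ i, P (p.1 i, p.2 i) (q.1 i, q.2 i)

section SitePower

variable {α β : Type*} [Fintype α] [Fintype β] [DecidableEq α]

omit [DecidableEq α] in
lemma sitePower_mul (n : ℕ) (P Q : Matrix (β × α) (β × α) ℂ) :
    sitePower n P * sitePower n Q = sitePower n (P * Q) := by
  ext p q
  simp only [sitePower, Matrix.mul_apply, Matrix.of_apply, Fintype.sum_prod_type,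
    Fintype.prod_sum, Finset.prod_mul_distrib]

omit [Fintype α] [Fintype β] [DecidableEq α] in
lemma sitePower_conjTranspose (n : ℕ) (P : Matrix (β × α) (β × α) ℂ) :
    (sitePower n P)ᴴ = sitePower n Pᴴ := by
  ext p q
  simp [sitePower]

open scoped MatrixOrder ComplexOrder in
-- Writing `P = Bᴴ B`, multiplicativity of `sitePower` exhibits the power as a Gram matrix. Together
-- with `sitePower_mul` this identifies the square root of the global Choi matrix site by site.
lemma sitePower_posSemidef [DecidableEq β] (n : ℕ) {P : Matrix (β × α) (β × α) ℂ}
    (hP : P.PosSemidef) : (sitePower n P).PosSemidef := by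
  obtain ⟨B, rfl⟩ := CStarAlgebra.nonneg_iff_eq_star_mul_self.mp hP.nonneg
  rw [Matrix.star_eq_conjTranspose, ← sitePower_mul, ← sitePower_conjTranspose]
  exact Matrix.posSemidef_conjTranspose_mul_self _

omit [Fintype β] in
lemma choi_tensorPower (n : ℕ) (N : Matrix α α ℂ →ₗ[ℂ] Matrix β β ℂ) :
    choi (tensorPower n N) = sitePower n (choi N) := by
  ext p q
  simp [choi, sitePower, tensorPower, Matrix.single_apply, ite_and]

end SitePower

/-! ### The two-qubit Clifford group is a unitary 2-design -/

/-- Two-qubit Pauli matrices. -/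
def pauliPair (a : Fin 4 × Fin 4) : Matrix (Fin 2 × Fin 2) (Fin 2 × Fin 2) ℂ :=
  pauli a.1 ⊗ₖ pauli a.2

/-- The sign `±1` with which two Pauli matrices commute. -/
def pauliSign (i j : Fin 4) : ℤ := if i = 0 ∨ j = 0 ∨ i = j then 1 else -1

/-- The sign `±1` with which two two-qubit Pauli matrices commute. -/
def pauliPairSign (a b : Fin 4 × Fin 4) : ℤ := pauliSign a.1 b.1 * pauliSign a.2 b.2

lemma pauli_mul_comm (i j : Fin 4) :
    pauli i * pauli j = (pauliSign i j : ℂ) • (pauli j * pauli i) := by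
  fin_cases i <;> fin_cases j <;> ext a b <;> fin_cases a <;> fin_cases b <;>
    simp [pauli, pauliSign]

lemma pauliPair_mul_comm (a b : Fin 4 × Fin 4) :
    pauliPair a * pauliPair b = (pauliPairSign a b : ℂ) • (pauliPair b * pauliPair a) := by
  simp only [pauliPair, ← Matrix.mul_kronecker_mul, pauliPairSign]
  rw [pauli_mul_comm, pauli_mul_comm a.2, Matrix.smul_kronecker, Matrix.kronecker_smul, smul_smul]
  push_cast
  rfl

lemma pauliPair_mul_self (a : Fin 4 × Fin 4) : pauliPair a * pauliPair a = 1 := by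
  simp [pauliPair, ← Matrix.mul_kronecker_mul, pauli_mul_self]

lemma pauliPair_conjTranspose (a : Fin 4 × Fin 4) : (pauliPair a)ᴴ = pauliPair a := by
  simp [pauliPair, Matrix.conjTranspose_kronecker, pauli_conjTranspose]

lemma pauliPairSign_eq (a b : Fin 4 × Fin 4) : pauliPairSign a b = 1 ∨ pauliPairSign a b = -1 := by
  unfold pauliPairSign pauliSign
  split_ifs <;> simp

/-- Nondegeneracy of the symplectic form on Pauli labels: some Pauli anticommutes with exactly one
of two different ones. -/
lemma exists_pauliPairSign_ne : ∀ a b : Fin 4 × Fin 4, a ≠ b →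
    ∃ c, pauliPairSign c a * pauliPairSign c b = -1 := by
  decide +kernel

/-- Over the field with two elements, nonzero labels are equal or linearly independent, so
prescribing symplectic product 1 with both is solvable. -/
lemma exists_anticommute_both : ∀ a b : Fin 4 × Fin 4, a ≠ 0 → b ≠ 0 →
    ∃ c, pauliPairSign a c = -1 ∧ pauliPairSign c b = -1 := by
  decide +kernel

lemma pauli_completeness (u v u' v' : Fin 2) :
    ∑ i, pauli i u v * pauli i u' v' = if u = v' ∧ u' = v then 2 else 0 := by
  rw [Fin.sum_univ_four]
  fin_cases u <;> fin_cases v <;> fin_cases u' <;> fin_cases v' <;> simp [pauli] <;> norm_num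

lemma pauliPair_completeness (u v u' v' : Fin 2 × Fin 2) :
    ∑ a, pauliPair a u v * pauliPair a u' v' = if u = v' ∧ u' = v then 4 else 0 := by
  have : ∑ a, pauliPair a u v * pauliPair a u' v' =
      (∑ i, pauli i u.1 v.1 * pauli i u'.1 v'.1) * (∑ j, pauli j u.2 v.2 * pauli j u'.2 v'.2) := by
    rw [Finset.sum_mul_sum, Fintype.sum_prod_type]
    refine Finset.sum_congr rfl fun i _ => Finset.sum_congr rfl fun j _ => ?_
    simp only [pauliPair, Matrix.kroneckerMap_apply]
    ring
  rw [this, pauli_completeness, pauli_completeness, ite_zero_mul_ite_zero]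
  refine if_congr ?_ (by norm_num) rfl
  simp only [Prod.ext_iff]
  tauto

/-- The swap operator on two copies of a system. -/
def swapMatrix (κ : Type*) [DecidableEq κ] : Matrix (κ × κ) (κ × κ) ℂ :=
  Matrix.of fun p q => if p.1 = q.2 ∧ p.2 = q.1 then 1 else 0

lemma sum_pauliPair_kronecker :
    ∑ a, pauliPair a ⊗ₖ pauliPair a = (4 : ℂ) • swapMatrix (Fin 2 × Fin 2) := by
  ext ⟨u, u'⟩ ⟨v, v'⟩
  simp [Matrix.sum_apply, pauliPair_completeness, swapMatrix]

lemma trace_kronecker_mul_swapMatrix {κ : Type*} [Fintype κ] [DecidableEq κ] (A B : Matrix κ κ ℂ) :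
    ((A ⊗ₖ B) * swapMatrix κ).trace = (A * B).trace := by
  simp only [Matrix.trace, Matrix.diag_apply, Matrix.mul_apply, Fintype.sum_prod_type,
    Matrix.kroneckerMap_apply, swapMatrix, Matrix.of_apply, mul_ite, mul_one, mul_zero, ite_and]
  simp

lemma kronecker_mul_swapMatrix {κ : Type*} [Fintype κ] [DecidableEq κ] (A B : Matrix κ κ ℂ) :
    (A ⊗ₖ B) * swapMatrix κ = swapMatrix κ * (B ⊗ₖ A) := by
  ext ⟨u, u'⟩ ⟨v, v'⟩
  simp [Matrix.mul_apply, Fintype.sum_prod_type, swapMatrix, ite_and, mul_comm]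

lemma swapMatrix_mul_self {κ : Type*} [Fintype κ] [DecidableEq κ] :
    swapMatrix κ * swapMatrix κ = 1 := by
  ext ⟨u, u'⟩ ⟨v, v'⟩
  simp [Matrix.mul_apply, Fintype.sum_prod_type, swapMatrix, ite_and, Matrix.one_apply, Prod.ext_iff]

lemma trace_pauli (i : Fin 4) : (pauli i).trace = if i = 0 then 2 else 0 := by
  fin_cases i <;> simp [pauli, Matrix.trace_fin_two]

lemma trace_pauliPair (a : Fin 4 × Fin 4) : (pauliPair a).trace = if a = 0 then 4 else 0 := by
  rw [pauliPair, Matrix.trace_kronecker, trace_pauli, trace_pauli, ite_zero_mul_ite_zero]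
  exact if_congr (by simp [Prod.ext_iff]) (by norm_num) rfl

lemma trace_pauli_mul (i j : Fin 4) : (pauli i * pauli j).trace = if i = j then 2 else 0 := by
  fin_cases i <;> fin_cases j <;> simp [pauli, Matrix.trace_fin_two] <;> norm_num

lemma trace_pauliPair_mul (a b : Fin 4 × Fin 4) :
    (pauliPair a * pauliPair b).trace = if a = b then 4 else 0 := by
  rw [pauliPair, pauliPair, ← Matrix.mul_kronecker_mul, Matrix.trace_kronecker, trace_pauli_mul,
    trace_pauli_mul, ite_zero_mul_ite_zero]
  exact if_congr (by simp [Prod.ext_iff]) (by norm_num) rfl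

lemma single_eq_sum_pauliPair (u v : Fin 2 × Fin 2) :
    Matrix.single u v (1 : ℂ) = (4⁻¹ : ℂ) • ∑ a, pauliPair a v u • pauliPair a := by
  ext x y
  simp only [Matrix.smul_apply, Matrix.sum_apply, smul_eq_mul, pauliPair_completeness,
    Matrix.single_apply]
  by_cases h1 : u = x <;> by_cases h2 : v = y <;> simp [h1, h2, Ne.symm]

lemma linearMap_ext_pauliPair {M : Type*} [AddCommGroup M] [Module ℂ M]
    {f g : Matrix ((Fin 2 × Fin 2) × Fin 2 × Fin 2) ((Fin 2 × Fin 2) × Fin 2 × Fin 2) ℂ →ₗ[ℂ] M}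
    (h : ∀ a b, f (pauliPair a ⊗ₖ pauliPair b) = g (pauliPair a ⊗ₖ pauliPair b)) : f = g := by
  have key (u u' v v' : Fin 2 × Fin 2) : Matrix.single (u, u') (v, v') (1 : ℂ) =
      ∑ a, ∑ b, (4⁻¹ * pauliPair a v u * (4⁻¹ * pauliPair b v' u')) •
        (pauliPair a ⊗ₖ pauliPair b) := by
    have : Matrix.single (u, u') (v, v') (1 : ℂ) =
        Matrix.single u v (1 : ℂ) ⊗ₖ Matrix.single u' v' (1 : ℂ) := by
      rw [Matrix.single_kronecker_single, mul_one]
    rw [this]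
    ext x y
    simp only [Matrix.kroneckerMap_apply, single_eq_sum_pauliPair, Matrix.smul_apply,
      Matrix.sum_apply, smul_eq_mul]
    rw [mul_mul_mul_comm, Finset.sum_mul_sum, Finset.mul_sum]
    refine Finset.sum_congr rfl fun a _ => ?_
    rw [Finset.mul_sum]
    refine Finset.sum_congr rfl fun b _ => ?_
    ring
  refine Matrix.ext_linearMap ℂ fun ⟨u, u'⟩ ⟨v, v'⟩ => LinearMap.ext_ring ?_
  simp only [LinearMap.comp_apply, Matrix.singleLinearMap_apply, key, map_sum, map_smul, h]

/-! #### Clifford unitaries that exchange two anticommuting Paulis -/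

/-- A two-qubit Pauli matrix as a unitary. -/
def pauliUnitary (a : Fin 4 × Fin 4) : U4 := ⟨pauliPair a, pauli_kronecker_mem_unitary a.1 a.2⟩

lemma pauliUnitary_mem (a : Fin 4 × Fin 4) : pauliUnitary a ∈ pauliGroup :=
  ⟨0, a.1, a.2, by simp [pauliUnitary, pauliPair]⟩

lemma pauliUnitary_mem_cliffordGroup (a : Fin 4 × Fin 4) : pauliUnitary a ∈ cliffordGroup :=
  Subgroup.le_normalizer (pauliUnitary_mem a)

lemma neg_mem_pauliGroup {U : U4} (hU : U ∈ pauliGroup) : -U ∈ pauliGroup := by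
  obtain ⟨c, i, j, h⟩ := hU
  refine ⟨c + 2, i, j, ?_⟩
  change -(U : Matrix (Fin 2 × Fin 2) (Fin 2 × Fin 2) ℂ) = _
  rw [h, pow_add, Complex.I_sq]
  simp

/-- The Clifford unitary `(P + Q) / √2` for anticommuting Pauli matrices `P` and `Q`. -/
def exchanger (a b : Fin 4 × Fin 4) : Matrix (Fin 2 × Fin 2) (Fin 2 × Fin 2) ℂ :=
  ((Real.sqrt 2 : ℂ)⁻¹) • (pauliPair a + pauliPair b)

lemma inv_sqrt_two_mul_self : ((Real.sqrt 2 : ℂ)⁻¹) * ((Real.sqrt 2 : ℂ)⁻¹) = 2⁻¹ := by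
  rw [← mul_inv, ← Complex.ofReal_mul, Real.mul_self_sqrt (by norm_num)]
  norm_num

lemma exchanger_conjTranspose (a b : Fin 4 × Fin 4) : (exchanger a b)ᴴ = exchanger a b := by
  simp [exchanger, Matrix.conjTranspose_smul, pauliPair_conjTranspose]

section Exchanger

variable {a b : Fin 4 × Fin 4} (hab : pauliPairSign a b = -1)

include hab

lemma pauliPair_anticommute : pauliPair b * pauliPair a = -(pauliPair a * pauliPair b) := by
  rw [pauliPair_mul_comm a b, hab]; simp

/-- Moving `X` to the left produces `(e + f) X + (e - f) X P Q`. For signs `e, f` only one of the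
two terms survives, so a Pauli matrix is mapped to a Pauli matrix up to sign. -/
lemma exchanger_mul_mul {X : Matrix (Fin 2 × Fin 2) (Fin 2 × Fin 2) ℂ} {e f : ℂ}
    (ha : pauliPair a * X = e • (X * pauliPair a)) (hb : pauliPair b * X = f • (X * pauliPair b)) :
    exchanger a b * X * exchanger a b =
      ((e + f) / 2) • X + ((e - f) / 2) • (X * pauliPair a * pauliPair b) := by
  have h : (pauliPair a + pauliPair b) * X * (pauliPair a + pauliPair b) =
      (e + f) • X + (e - f) • (X * pauliPair a * pauliPair b) := by
    rw [Matrix.add_mul, ha, hb]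
    simp only [Matrix.add_mul, Matrix.mul_add, Matrix.smul_mul, Matrix.mul_assoc,
      pauliPair_mul_self, pauliPair_anticommute hab, Matrix.mul_one, Matrix.mul_neg]
    module
  rw [exchanger, Matrix.smul_mul, Matrix.smul_mul, Matrix.mul_smul, smul_smul,
    inv_sqrt_two_mul_self, h]
  module

lemma exchanger_mul_self : exchanger a b * exchanger a b = 1 := by
  have := exchanger_mul_mul hab (X := 1) (e := 1) (f := 1) (by simp) (by simp)
  simpa using this

lemma exchanger_conj_left : exchanger a b * pauliPair a * exchanger a b = pauliPair b := by
  rw [exchanger_mul_mul hab (e := 1) (f := -1) (by simp)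
    (by rw [pauliPair_anticommute hab]; simp)]
  norm_num [pauliPair_mul_self]

lemma exists_exchanger_mem_cliffordGroup : ∃ U ∈ cliffordGroup,
    (U : Matrix (Fin 2 × Fin 2) (Fin 2 × Fin 2) ℂ) = exchanger a b := by
  have hmem : exchanger a b ∈ Matrix.unitaryGroup (Fin 2 × Fin 2) ℂ := by
    rw [Matrix.mem_unitaryGroup_iff, Matrix.star_eq_conjTranspose, exchanger_conjTranspose,
      exchanger_mul_self hab]
  set U : U4 := ⟨exchanger a b, hmem⟩ with hU
  have hinv : U⁻¹ = U := by
    rw [inv_eq_iff_mul_eq_one]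
    exact Subtype.ext (exchanger_mul_self hab)
  have key : ∀ h ∈ pauliGroup, U * h * U ∈ pauliGroup := by
    intro h hh
    obtain ⟨c, i, j, hc⟩ := id hh
    have hcomm (x : Fin 4 × Fin 4) :
        pauliPair x * (h : Matrix (Fin 2 × Fin 2) (Fin 2 × Fin 2) ℂ) =
          (pauliPairSign x (i, j) : ℂ) •
            ((h : Matrix (Fin 2 × Fin 2) (Fin 2 × Fin 2) ℂ) * pauliPair x) := by
      rw [hc, Matrix.mul_smul, Matrix.smul_mul, smul_comm]
      exact congrArg _ (pauliPair_mul_comm x (i, j))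
    have hmat := exchanger_mul_mul hab (hcomm a) (hcomm b)
    have hhab : h * pauliUnitary a * pauliUnitary b ∈ pauliGroup :=
      mul_mem (mul_mem hh (pauliUnitary_mem a)) (pauliUnitary_mem b)
    rcases pauliPairSign_eq a (i, j) with h1 | h1 <;> rcases pauliPairSign_eq b (i, j) with h2 | h2
      <;> rw [h1, h2] at hmat
    · have : U * h * U = h := Subtype.ext (hmat.trans (by norm_num))
      rw [this]
      exact hh
    · have : U * h * U = h * pauliUnitary a * pauliUnitary b :=
        Subtype.ext (hmat.trans (by norm_num [pauliUnitary]))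
      rw [this]
      exact hhab
    · have : U * h * U = -(h * pauliUnitary a * pauliUnitary b) :=
        Subtype.ext (hmat.trans (by norm_num; rfl))
      rw [this]
      exact neg_mem_pauliGroup hhab
    · have : U * h * U = -h := Subtype.ext (hmat.trans (by norm_num; rfl))
      rw [this]
      exact neg_mem_pauliGroup hh
  refine ⟨U, ?_, rfl⟩
  rw [cliffordGroup, Subgroup.mem_normalizer_iff]
  intro h
  rw [hinv]
  -- `U` is an involution, so the converse inclusion is `key` applied to `U * h * U`.
  refine ⟨key h, fun hh => ?_⟩
  have hUU : U * U = 1 := by rw [← inv_eq_iff_mul_eq_one, hinv]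
  have := key _ hh
  rwa [show U * (U * h * U) * U = (U * U) * h * (U * U) by group, hUU, one_mul, mul_one] at this

end Exchanger

/-! #### The twirl -/

/-- The average of `(G ⊗ G) Y (G ⊗ G)ᴴ` over two-qubit Clifford gates `G`. -/
def twirl : Matrix ((Fin 2 × Fin 2) × Fin 2 × Fin 2) ((Fin 2 × Fin 2) × Fin 2 × Fin 2) ℂ →ₗ[ℂ]
    Matrix ((Fin 2 × Fin 2) × Fin 2 × Fin 2) ((Fin 2 × Fin 2) × Fin 2 × Fin 2) ℂ :=
  (Fintype.card CliffordGate : ℂ)⁻¹ • ∑ g : CliffordGate, conjMap (g.toMatrix ⊗ₖ g.toMatrix)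

lemma conjMap_kronecker {κ : Type*} [Fintype κ] (G A B : Matrix κ κ ℂ) :
    conjMap (G ⊗ₖ G) (A ⊗ₖ B) = (G * A * Gᴴ) ⊗ₖ (G * B * Gᴴ) := by
  simp [conjMap, Matrix.conjTranspose_kronecker, Matrix.mul_kronecker_mul]

lemma conjMap_mul {α β γ : Type*} [Fintype α] [Fintype β] (A : Matrix γ β ℂ) (B : Matrix β α ℂ)
    (X : Matrix α α ℂ) : conjMap (A * B) X = conjMap A (conjMap B X) := by
  simp [conjMap, Matrix.conjTranspose_mul, Matrix.mul_assoc]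

instance phases_normal : (phases.subgroupOf cliffordGroup).Normal := by
  refine ⟨fun n hn g => ?_⟩
  obtain ⟨c, hc⟩ := hn
  refine ⟨c, ?_⟩
  change ((g : U4) * (n : U4) * (g : U4)⁻¹ : U4).1 = _
  have hc' : ((n : U4) : Matrix (Fin 2 × Fin 2) (Fin 2 × Fin 2) ℂ) = c • 1 := hc
  have hg : (g : U4).1 * ((g : U4)⁻¹ : U4).1 = 1 := congrArg Subtype.val (mul_inv_cancel (g : U4))
  rw [Matrix.UnitaryGroup.mul_val, Matrix.UnitaryGroup.mul_val, hc', Matrix.mul_smul,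
    Matrix.mul_one, Matrix.smul_mul, hg]

lemma conjMap_phase {U V : U4} {c : ℂ} (h : (U : Matrix (Fin 2 × Fin 2) (Fin 2 × Fin 2) ℂ) = c • 1)
    (Y : Matrix ((Fin 2 × Fin 2) × Fin 2 × Fin 2) ((Fin 2 × Fin 2) × Fin 2 × Fin 2) ℂ) :
    conjMap ((V * U : U4).1 ⊗ₖ (V * U : U4).1) Y = conjMap (V.1 ⊗ₖ V.1) Y := by
  have hc : c * star c = 1 := by
    have := Matrix.mem_unitaryGroup_iff.mp U.2
    rw [h, Matrix.star_eq_conjTranspose] at this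
    have := congrFun (congrFun this (0, 0)) (0, 0)
    simpa [mul_comm] using this
  rw [Matrix.UnitaryGroup.mul_val, h, Matrix.mul_smul, Matrix.mul_one]
  simp only [conjMap, LinearMap.coe_mk, AddHom.coe_mk, Matrix.smul_kronecker,
    Matrix.kronecker_smul, Matrix.conjTranspose_smul, Matrix.smul_mul, Matrix.mul_smul, smul_smul]
  rw [show star (c * c) * (c * c) = (c * star c) * (c * star c) by
    rw [star_mul]; ring, hc]
  simp

/-- The chosen representative differs from `U` by a phase of modulus one, which cancels in the
conjugation. -/
lemma conjMap_out_mk (U : cliffordGroup)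
    (Y : Matrix ((Fin 2 × Fin 2) × Fin 2 × Fin 2) ((Fin 2 × Fin 2) × Fin 2 × Fin 2) ℂ) :
    conjMap ((CliffordGate.toMatrix (U : CliffordGate)) ⊗ₖ
      (CliffordGate.toMatrix (U : CliffordGate))) Y = conjMap (U.1.1 ⊗ₖ U.1.1) Y := by
  obtain ⟨⟨N, c, hc⟩, hN⟩ := QuotientGroup.mk_out_eq_mul (phases.subgroupOf cliffordGroup) U
  rw [CliffordGate.toMatrix]
  change conjMap (((Quotient.out (U : CliffordGate) : cliffordGroup) : U4).1 ⊗ₖ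
    ((Quotient.out (U : CliffordGate) : cliffordGroup) : U4).1) Y = _
  rw [hN]
  exact conjMap_phase hc Y

/-- Right translation permutes the finite group of Clifford gates; normality of the phases supplies
the group structure. -/
lemma twirl_conjMap {U : U4} (hU : U ∈ cliffordGroup)
    (Y : Matrix ((Fin 2 × Fin 2) × Fin 2 × Fin 2) ((Fin 2 × Fin 2) × Fin 2 × Fin 2) ℂ) :
    twirl (conjMap (U.1 ⊗ₖ U.1) Y) = twirl Y := by
  simp only [twirl, LinearMap.smul_apply, LinearMap.sum_apply]
  congr 1
  refine Fintype.sum_equiv (Equiv.mulRight ((⟨U, hU⟩ : cliffordGroup) : CliffordGate)) _ _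
    fun g => ?_
  obtain ⟨W, rfl⟩ := QuotientGroup.mk_surjective g
  have hW : Equiv.mulRight ((⟨U, hU⟩ : cliffordGroup) : CliffordGate) (W : CliffordGate) =
      ((W * ⟨U, hU⟩ : cliffordGroup) : CliffordGate) := rfl
  rw [conjMap_out_mk, ← conjMap_mul, ← Matrix.mul_kronecker_mul, hW, conjMap_out_mk,
    Subgroup.coe_mul, Matrix.UnitaryGroup.mul_val]

lemma conjMap_unitary_one (U : U4) : conjMap (U.1 ⊗ₖ U.1) 1 = 1 := by
  have hU := Matrix.mem_unitaryGroup_iff.mp U.2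
  rw [← Matrix.one_kronecker_one, conjMap_kronecker, Matrix.mul_one,
    ← Matrix.star_eq_conjTranspose, hU]

lemma conjMap_unitary_swapMatrix (U : U4) :
    conjMap (U.1 ⊗ₖ U.1) (swapMatrix (Fin 2 × Fin 2)) = swapMatrix (Fin 2 × Fin 2) := by
  have h := conjMap_unitary_one U
  simp only [conjMap, LinearMap.coe_mk, AddHom.coe_mk, Matrix.mul_one] at h ⊢
  rw [kronecker_mul_swapMatrix, Matrix.mul_assoc, h, Matrix.mul_one]

lemma card_cliffordGate_ne_zero : (Fintype.card CliffordGate : ℂ) ≠ 0 := by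
  have : Nonempty CliffordGate := ⟨((1 : cliffordGroup) : CliffordGate)⟩
  exact_mod_cast Fintype.card_ne_zero

lemma twirl_of_invariant
    {Y : Matrix ((Fin 2 × Fin 2) × Fin 2 × Fin 2) ((Fin 2 × Fin 2) × Fin 2 × Fin 2) ℂ}
    (h : ∀ U : U4, conjMap (U.1 ⊗ₖ U.1) Y = Y) : twirl Y = Y := by
  have h' (g : CliffordGate) : conjMap (g.toMatrix ⊗ₖ g.toMatrix) Y = Y := h _
  simp only [twirl, LinearMap.smul_apply, LinearMap.sum_apply, h', Finset.sum_const,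
    Finset.card_univ, ← Nat.cast_smul_eq_nsmul ℂ, smul_smul]
  rw [inv_mul_cancel₀ card_cliffordGate_ne_zero, one_smul]

lemma twirl_one : twirl 1 = 1 := twirl_of_invariant conjMap_unitary_one

lemma twirl_swapMatrix : twirl (swapMatrix (Fin 2 × Fin 2)) = swapMatrix (Fin 2 × Fin 2) :=
  twirl_of_invariant conjMap_unitary_swapMatrix

/-- Conjugation by a Pauli that anticommutes with exactly one factor flips the sign but leaves the
twirl unchanged, so the twirl equals its own negative. -/
lemma twirl_pauliPair_of_ne {a b : Fin 4 × Fin 4} (hab : a ≠ b) :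
    twirl (pauliPair a ⊗ₖ pauliPair b) = 0 := by
  obtain ⟨c, hc⟩ := exists_pauliPairSign_ne a b hab
  have h := twirl_conjMap (pauliUnitary_mem_cliffordGroup c) (pauliPair a ⊗ₖ pauliPair b)
  have h1 (x : Fin 4 × Fin 4) : pauliPair c * pauliPair x * pauliPair c =
      (pauliPairSign c x : ℂ) • pauliPair x := by
    rw [pauliPair_mul_comm, Matrix.smul_mul, Matrix.mul_assoc, pauliPair_mul_self, Matrix.mul_one]
  rw [conjMap_kronecker, show (pauliUnitary c).1 = pauliPair c from rfl, pauliPair_conjTranspose,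
    h1, h1, Matrix.smul_kronecker, Matrix.kronecker_smul, smul_smul, ← Int.cast_mul, hc] at h
  rw [map_smul, Int.cast_neg, Int.cast_one, neg_smul, one_smul] at h
  set T := twirl (pauliPair a ⊗ₖ pauliPair b)
  have h2 : (2 : ℂ) • T = 0 := by
    rw [two_smul]
    nth_rw 1 [← h]
    exact neg_add_cancel T
  exact (smul_eq_zero.mp h2).resolve_left two_ne_zero

lemma twirl_pauliPair_eq_of_sign {a b : Fin 4 × Fin 4} (hab : pauliPairSign a b = -1) :
    twirl (pauliPair a ⊗ₖ pauliPair a) = twirl (pauliPair b ⊗ₖ pauliPair b) := by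
  obtain ⟨U, hU, hUe⟩ := exists_exchanger_mem_cliffordGroup hab
  rw [← twirl_conjMap hU, conjMap_kronecker, hUe, exchanger_conjTranspose, exchanger_conj_left hab]

lemma twirl_pauliPair_eq {a b : Fin 4 × Fin 4} (ha : a ≠ 0) (hb : b ≠ 0) :
    twirl (pauliPair a ⊗ₖ pauliPair a) = twirl (pauliPair b ⊗ₖ pauliPair b) := by
  obtain ⟨c, h1, h2⟩ := exists_anticommute_both a b ha hb
  rw [twirl_pauliPair_eq_of_sign h1, twirl_pauliPair_eq_of_sign h2]

lemma pauliPair_zero : pauliPair 0 = 1 := by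
  simp [pauliPair, pauli]

/-- The sum of all `P ⊗ P` is `4 S`, which the twirl fixes. The identity contributes `1`, and the 15
remaining twirls coincide. -/
lemma twirl_pauliPair_of_ne_zero {a : Fin 4 × Fin 4} (ha : a ≠ 0) :
    twirl (pauliPair a ⊗ₖ pauliPair a) =
      (15⁻¹ : ℂ) • ((4 : ℂ) • swapMatrix (Fin 2 × Fin 2) - 1) := by
  have h : twirl ((4 : ℂ) • swapMatrix (Fin 2 × Fin 2)) =
      1 + (15 : ℂ) • twirl (pauliPair a ⊗ₖ pauliPair a) := by
    rw [← sum_pauliPair_kronecker, map_sum,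
      ← Finset.add_sum_erase _ _ (Finset.mem_univ (0 : Fin 4 × Fin 4)),
      pauliPair_zero, Matrix.one_kronecker_one, twirl_one]
    congr 1
    rw [Finset.sum_congr rfl fun b hb => twirl_pauliPair_eq (Finset.ne_of_mem_erase hb) ha,
      Finset.sum_const, Finset.card_erase_of_mem (Finset.mem_univ _), Finset.card_univ,
      ← Nat.cast_smul_eq_nsmul ℂ]
    congr 1
  rw [map_smul, twirl_swapMatrix] at h
  rw [h, add_sub_cancel_left, smul_smul]
  norm_num

/-- The coefficients `α, β` of `1` and `S` solve tr Y = 16α + 4β and tr(Y S) = 4α + 16β; hence the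
denominator 60. By linearity it suffices to compare both sides on Pauli products. -/
lemma twirl_eq
    (Y : Matrix ((Fin 2 × Fin 2) × Fin 2 × Fin 2) ((Fin 2 × Fin 2) × Fin 2 × Fin 2) ℂ) :
    twirl Y = ((4 * Y.trace - (Y * swapMatrix _).trace) / 60) • 1 +
      ((4 * (Y * swapMatrix _).trace - Y.trace) / 60) • swapMatrix _ := by
  obtain ⟨g, hg⟩ : ∃ g : Matrix ((Fin 2 × Fin 2) × Fin 2 × Fin 2)
      ((Fin 2 × Fin 2) × Fin 2 × Fin 2) ℂ →ₗ[ℂ] Matrix ((Fin 2 × Fin 2) × Fin 2 × Fin 2)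
      ((Fin 2 × Fin 2) × Fin 2 × Fin 2) ℂ, ∀ Y, g Y =
        ((4 * Y.trace - (Y * swapMatrix _).trace) / 60) • 1 +
          ((4 * (Y * swapMatrix _).trace - Y.trace) / 60) • swapMatrix _ :=
    ⟨{  toFun := fun Y => ((4 * Y.trace - (Y * swapMatrix _).trace) / 60) • 1 +
          ((4 * (Y * swapMatrix _).trace - Y.trace) / 60) • swapMatrix _
        map_add' := fun Y Z => by
          simp only [Matrix.trace_add, Matrix.add_mul]
          module
        map_smul' := fun c Y => by
          simp only [Matrix.trace_smul, Matrix.smul_mul, RingHom.id_apply, smul_eq_mul]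
          module }, fun _ => rfl⟩
  have : twirl = g := by
    refine linearMap_ext_pauliPair fun a b => ?_
    rw [hg]
    rw [trace_kronecker_mul_swapMatrix, trace_pauliPair_mul, Matrix.trace_kronecker,
      trace_pauliPair, trace_pauliPair]
    by_cases hab : a = b
    · subst hab
      by_cases ha : a = 0
      · subst ha
        rw [pauliPair_zero, Matrix.one_kronecker_one, twirl_one]
        norm_num
      · rw [twirl_pauliPair_of_ne_zero ha]
        simp only [ha, if_true, if_false]
        module
    · rw [twirl_pauliPair_of_ne hab]
      have : ¬ (a = 0 ∧ b = 0) := fun h => hab (h.1.trans h.2.symm)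
      rw [ite_zero_mul_ite_zero, if_neg this, if_neg hab]
      simp
  rw [this, hg]

/-! ### Product tensors on two copies of `n` qubits -/

/-- Matrices on two copies of one qubit. -/
abbrev SiteMatrix : Type := Matrix (Fin 2 × Fin 2) (Fin 2 × Fin 2) ℂ

/-- Matrices on two copies of two qubits. -/
abbrev PairMatrix : Type :=
  Matrix ((Fin 2 × Fin 2) × Fin 2 × Fin 2) ((Fin 2 × Fin 2) × Fin 2 × Fin 2) ℂ

/-- Matrices on two copies of `n` qubits. -/
abbrev DoubleMatrix (n : ℕ) : Type := Matrix (Qubits n × Qubits n) (Qubits n × Qubits n) ℂ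

/-- The tensor product of matrices `t i` on the two copies of the qubits `i`. -/
def productTensor {n : ℕ} (t : Fin n → SiteMatrix) : DoubleMatrix n :=
  Matrix.of fun p q => ∏ i, t i (p.1 i, p.2 i) (q.1 i, q.2 i)

/-- The tensor product of two matrices on two copies of one qubit each. -/
def pairTensor (s t : SiteMatrix) : PairMatrix :=
  Matrix.of fun a b => s (a.1.1, a.2.1) (b.1.1, b.2.1) * t (a.1.2, a.2.2) (b.1.2, b.2.2)

/-- The tensor product of a matrix `Y` on the two copies of the qubits `x` and `y` and of matrices
`t i` on the two copies of the other qubits `i`. -/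
def insertPair {n : ℕ} (x y : Fin n) (t : Fin n → SiteMatrix) : PairMatrix →ₗ[ℂ] DoubleMatrix n where
  toFun Y := Matrix.of fun p q =>
    Y ((p.1 x, p.1 y), (p.2 x, p.2 y)) ((q.1 x, q.1 y), (q.2 x, q.2 y)) *
      ∏ i ∈ {x, y}ᶜ, t i (p.1 i, p.2 i) (q.1 i, q.2 i)
  map_add' Y Z := by
    ext p q
    simp [add_mul]
  map_smul' c Y := by
    ext p q
    simp [mul_assoc]

/-- Overwrite the values at `x` and `y`. -/
def setPair {n : ℕ} {κ : Type*} (x y : Fin n) (u : Fin n → κ) (p : κ × κ) : Fin n → κ :=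
  Function.update (Function.update u x p.1) y p.2

section SetPair

variable {n : ℕ} {κ : Type*} {x y : Fin n}

lemma setPair_right (u : Fin n → κ) (p : κ × κ) : setPair x y u p y = p.2 := by
  simp [setPair]

lemma setPair_left (hxy : x ≠ y) (u : Fin n → κ) (p : κ × κ) : setPair x y u p x = p.1 := by
  simp [setPair, hxy]

lemma setPair_of_ne (u : Fin n → κ) (p : κ × κ) {z : Fin n} (hx : z ≠ x) (hy : z ≠ y) :
    setPair x y u p z = u z := by
  simp [setPair, hx, hy]

lemma setPair_of_mem_compl (u : Fin n → κ) (p : κ × κ) {z : Fin n}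
    (hz : z ∈ ({x, y} : Finset (Fin n))ᶜ) : setPair x y u p z = u z := by
  simp only [Finset.mem_compl, Finset.mem_insert, Finset.mem_singleton, not_or] at hz
  exact setPair_of_ne u p hz.1 hz.2

lemma setPair_injective (hxy : x ≠ y) (u : Fin n → κ) : Function.Injective (setPair x y u) := by
  intro p q h
  have h1 := congrFun h x
  have h2 := congrFun h y
  rw [setPair_left hxy, setPair_left hxy] at h1
  rw [setPair_right, setPair_right] at h2
  exact Prod.ext h1 h2

lemma eq_setPair (u v : Fin n → κ) (h : ∀ z, z ≠ x → z ≠ y → u z = v z) :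
    v = setPair x y u (v x, v y) := by
  funext z
  by_cases hy : z = y
  · subst hy; rw [setPair_right]
  · by_cases hx : z = x
    · subst hx; simp [setPair, hy]
    · rw [setPair_of_ne _ _ hx hy, h z hx hy]

lemma setPair_comp {κ' : Type*} (f : κ → κ') (u : Fin n → κ) (p : κ × κ) :
    (fun i => f (setPair x y u p i)) = setPair x y (fun i => f (u i)) (f p.1, f p.2) := by
  funext z
  simp only [setPair, Function.update_apply]
  split_ifs <;> rfl

end SetPair

/-! ### Action of a two-qubit gate on product tensors -/

section Gate

variable {n : ℕ} {x y : Fin n} (hxy : x ≠ y)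

include hxy

/-- The row of `u` is supported on the labels that agree with `u` off `{x, y}`; for `x ≠ y` these
are parametrized bijectively by their two values there. -/
lemma sum_onPair_mul (G : Matrix (Fin 2 × Fin 2) (Fin 2 × Fin 2) ℂ) (u : Qubits n)
    (f : Qubits n → ℂ) :
    ∑ w, onPair x y G u w * f w = ∑ p, G (u x, u y) p * f (setPair x y u p) := by
  symm
  refine Fintype.sum_of_injective (setPair x y u) (setPair_injective hxy u) _ _ ?_ ?_
  · intro w hw
    have : ¬ ∀ z, z ≠ x → z ≠ y → u z = w z := fun h => hw ⟨_, (eq_setPair u w h).symm⟩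
    simp only [onPair, Matrix.of_apply, if_neg this, zero_mul]
  · intro p
    have : ∀ z, z ≠ x → z ≠ y → u z = setPair x y u p z := fun z hx hy =>
      (setPair_of_ne u p hx hy).symm
    simp only [onPair, Matrix.of_apply, if_pos this, setPair_left hxy, setPair_right]

lemma onPair_kronecker_mul_insertPair (G : Matrix (Fin 2 × Fin 2) (Fin 2 × Fin 2) ℂ)
    (t : Fin n → SiteMatrix) (Y : PairMatrix) :
    (onPair x y G ⊗ₖ onPair x y G) * insertPair x y t Y = insertPair x y t ((G ⊗ₖ G) * Y) := by
  ext ⟨u, u'⟩ q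
  rw [Matrix.mul_apply, Fintype.sum_prod_type]
  simp only [Matrix.kroneckerMap_apply, mul_assoc]
  simp only [← Finset.mul_sum]
  rw [sum_onPair_mul hxy]
  simp only [sum_onPair_mul hxy]
  simp only [insertPair, LinearMap.coe_mk, AddHom.coe_mk, Matrix.of_apply, setPair_left hxy,
    setPair_right, Matrix.mul_apply, Matrix.kroneckerMap_apply]
  rw [Fintype.sum_prod_type (α₁ := Fin 2 × Fin 2), Finset.sum_mul]
  refine Finset.sum_congr rfl fun p _ => ?_
  rw [Finset.mul_sum, Finset.sum_mul]
  refine Finset.sum_congr rfl fun p' _ => ?_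
  rw [Finset.prod_congr rfl fun i hi => by
    rw [setPair_of_mem_compl u p hi, setPair_of_mem_compl u' p' hi]]
  ring

omit hxy in
lemma insertPair_conjTranspose (t : Fin n → SiteMatrix) (Y : PairMatrix) :
    (insertPair x y t Y)ᴴ = insertPair x y (fun i => (t i)ᴴ) Yᴴ := by
  ext p q
  simp [insertPair]

lemma conjMap_onPair_insertPair (G : Matrix (Fin 2 × Fin 2) (Fin 2 × Fin 2) ℂ)
    (t : Fin n → SiteMatrix) (Y : PairMatrix) :
    conjMap (onPair x y G ⊗ₖ onPair x y G) (insertPair x y t Y) =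
      insertPair x y t (conjMap (G ⊗ₖ G) Y) := by
  simp only [conjMap, LinearMap.coe_mk, AddHom.coe_mk]
  rw [onPair_kronecker_mul_insertPair hxy]
  -- Right multiplication by the adjoint gate is the adjoint of left multiplication by the gate.
  have h := congrArg Matrix.conjTranspose (onPair_kronecker_mul_insertPair hxy G
    (fun i => (t i)ᴴ) ((G ⊗ₖ G) * Y)ᴴ)
  rw [Matrix.conjTranspose_mul, insertPair_conjTranspose, insertPair_conjTranspose,
    Matrix.conjTranspose_mul (G ⊗ₖ G) (_)ᴴ] at h
  simpa only [Matrix.conjTranspose_conjTranspose] using h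

lemma productTensor_setPair (t : Fin n → SiteMatrix) (p : SiteMatrix × SiteMatrix) :
    productTensor (setPair x y t p) = insertPair x y t (pairTensor p.1 p.2) := by
  ext u v
  simp only [productTensor, insertPair, pairTensor, LinearMap.coe_mk, AddHom.coe_mk,
    Matrix.of_apply]
  rw [← Finset.prod_mul_prod_compl ({x, y} : Finset (Fin n)), Finset.prod_pair hxy,
    setPair_left hxy, setPair_right]
  congr 1
  exact Finset.prod_congr rfl fun i hi => by rw [setPair_of_mem_compl t p hi]

end Gate

lemma productTensor_eq_insertPair {n : ℕ} {x y : Fin n} (hxy : x ≠ y) (t : Fin n → SiteMatrix) :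
    productTensor t = insertPair x y t (pairTensor (t x) (t y)) := by
  conv_lhs => rw [eq_setPair (x := x) (y := y) t t fun _ _ _ => rfl]
  rw [productTensor_setPair hxy]

/-- The operators `I` and `S` on two copies of one qubit. -/
def siteOp : Bool → SiteMatrix
  | false => 1
  | true => swapMatrix (Fin 2)

lemma pairTensor_one : pairTensor (siteOp false) (siteOp false) = 1 := by
  ext a b
  simp only [pairTensor, siteOp, Matrix.of_apply, Matrix.one_apply, ite_zero_mul_ite_zero, mul_one]
  exact if_congr (by simp only [Prod.ext_iff]; tauto) rfl rfl

lemma pairTensor_swapMatrix :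
    pairTensor (siteOp true) (siteOp true) = swapMatrix (Fin 2 × Fin 2) := by
  ext a b
  simp only [pairTensor, siteOp, swapMatrix, Matrix.of_apply, ite_zero_mul_ite_zero, mul_one]
  exact if_congr (by simp only [Prod.ext_iff]; tauto) rfl rfl

lemma trace_pairTensor (s t : SiteMatrix) : (pairTensor s t).trace = s.trace * t.trace := by
  simp only [Matrix.trace, Matrix.diag_apply, pairTensor, Matrix.of_apply, Fintype.sum_prod_type,
    Fin.sum_univ_two]
  ring

lemma trace_pairTensor_mul_swapMatrix (s t : SiteMatrix) :
    (pairTensor s t * swapMatrix _).trace =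
      (s * swapMatrix _).trace * (t * swapMatrix _).trace := by
  have h {κ : Type} [Fintype κ] [DecidableEq κ] (Y : Matrix (κ × κ) (κ × κ) ℂ) :
      (Y * swapMatrix κ).trace = ∑ u, ∑ v, Y (u, v) (v, u) := by
    simp [Matrix.trace, Matrix.mul_apply, Fintype.sum_prod_type, swapMatrix, ite_and]
  rw [h, h, h]
  simp only [pairTensor, Matrix.of_apply, Fintype.sum_prod_type, Fin.sum_univ_two]
  ring

/-- The coefficient of `I ⊗ I` or `S ⊗ S` in the twirl of `s ⊗ t`. -/
def twirlCoeff (s t : SiteMatrix) : Bool → ℂ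
  | false => (4 * (s.trace * t.trace) -
      (s * swapMatrix _).trace * (t * swapMatrix _).trace) / 60
  | true => (4 * ((s * swapMatrix _).trace * (t * swapMatrix _).trace) -
      s.trace * t.trace) / 60

/-! ### Averages over random circuits -/

/-- The second moment of a uniformly random Clifford gate on the qubits `x` and `y`. -/
def gateChannel {n : ℕ} (x y : Fin n) : DoubleMatrix n →ₗ[ℂ] DoubleMatrix n :=
  (Fintype.card CliffordGate : ℂ)⁻¹ •
    ∑ g : CliffordGate, conjMap (onPair x y g.toMatrix ⊗ₖ onPair x y g.toMatrix)

lemma gateChannel_productTensor {n : ℕ} {x y : Fin n} (hxy : x ≠ y) (t : Fin n → SiteMatrix) :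
    gateChannel x y (productTensor t) = ∑ ν, twirlCoeff (t x) (t y) ν •
      productTensor (setPair x y t (siteOp ν, siteOp ν)) := by
  have h : gateChannel x y (productTensor t) =
      insertPair x y t (twirl (pairTensor (t x) (t y))) := by
    rw [productTensor_eq_insertPair hxy]
    simp only [gateChannel, twirl, LinearMap.smul_apply, LinearMap.sum_apply,
      conjMap_onPair_insertPair hxy, map_smul, map_sum]
  rw [h, twirl_eq, trace_pairTensor, trace_pairTensor_mul_swapMatrix, Fintype.sum_bool,
    productTensor_setPair hxy, productTensor_setPair hxy, pairTensor_one, pairTensor_swapMatrix,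
    map_add, map_smul, map_smul, add_comm]
  rfl

/-- The second moment of a random circuit; gate number `0` is applied first. -/
def circuitChannel {n : ℕ} : ∀ {s : ℕ}, (Fin s → Fin n) → (Fin s → Fin n) →
    DoubleMatrix n →ₗ[ℂ] DoubleMatrix n
  | 0, _, _ => LinearMap.id
  | _ + 1, x, y => circuitChannel (Fin.tail x) (Fin.tail y) ∘ₗ gateChannel (x 0) (y 0)

/-- The circuit with the gates `g t` on the qubits `x t` and `y t`. -/
def circuitMatrix {n s : ℕ} (x y : Fin s → Fin n) (g : Fin s → CliffordGate) :
    Matrix (Qubits n) (Qubits n) ℂ :=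
  ((List.ofFn fun t => onPair (x t) (y t) (g t).toMatrix).reverse).prod

lemma circuitMatrix_cons {n s : ℕ} (x y : Fin (s + 1) → Fin n) (g₀ : CliffordGate)
    (g : Fin s → CliffordGate) :
    circuitMatrix x y (Fin.cons g₀ g : Fin (s + 1) → CliffordGate) =
      circuitMatrix (Fin.tail x) (Fin.tail y) g * onPair (x 0) (y 0) g₀.toMatrix := by
  simp [circuitMatrix, List.ofFn_succ, Fin.tail]

/-- Independence turns the average over circuits into a composition of one-gate averages. The first
gate is the rightmost factor, so it is peeled off as the innermost map. -/
lemma sum_conjMap_circuitMatrix {n s : ℕ} (x y : Fin s → Fin n) (T : DoubleMatrix n) :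
    ∑ g : Fin s → CliffordGate, conjMap (circuitMatrix x y g ⊗ₖ circuitMatrix x y g) T =
      (Fintype.card CliffordGate : ℂ) ^ s • circuitChannel x y T := by
  induction s generalizing T with
  | zero => simp [circuitMatrix, circuitChannel, conjMap]
  | succ s ih =>
    rw [← (Fin.consEquiv fun _ : Fin (s + 1) => CliffordGate).sum_comp, Fintype.sum_prod_type]
    have hg (g₀ : CliffordGate) (g : Fin s → CliffordGate) :
        (Fin.consEquiv fun _ : Fin (s + 1) => CliffordGate) (g₀, g) = Fin.cons g₀ g := rfl
    simp only [hg, circuitMatrix_cons, Matrix.mul_kronecker_mul, conjMap_mul, ih]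
    rw [← Finset.smul_sum, ← map_sum, pow_succ, circuitChannel, LinearMap.comp_apply, gateChannel]
    simp only [LinearMap.smul_apply, LinearMap.sum_apply, map_smul, smul_smul]
    rw [mul_assoc, mul_inv_cancel₀ card_cliffordGate_ne_zero, mul_one]

/-- A gate reads its two sites only through the traces against `I` and `S`, and then overwrites
them. Two inputs with equal traces therefore become equal once every site where they differ has been
touched. -/
lemma circuitChannel_congr {n s : ℕ} {x y : Fin s → Fin n} (hxy : ∀ k, x k ≠ y k)
    {t t' : Fin n → SiteMatrix} (htr : ∀ i, (t i).trace = (t' i).trace)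
    (hsw : ∀ i, (t i * swapMatrix _).trace = (t' i * swapMatrix _).trace)
    (hcov : ∀ i, t i = t' i ∨ ∃ k, x k = i ∨ y k = i) :
    circuitChannel x y (productTensor t) = circuitChannel x y (productTensor t') := by
  induction s generalizing t t' with
  | zero =>
    have : t = t' := funext fun i => (hcov i).resolve_right fun ⟨k, _⟩ => k.elim0
    rw [this]
  | succ s ih =>
    simp only [circuitChannel, LinearMap.comp_apply, gateChannel_productTensor (hxy 0), map_sum,
      map_smul]
    refine Finset.sum_congr rfl fun ν _ => ?_
    have hc : twirlCoeff (t (x 0)) (t (y 0)) ν = twirlCoeff (t' (x 0)) (t' (y 0)) ν := by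
      cases ν <;> simp only [twirlCoeff, htr, hsw]
    rw [hc]
    congr 1
    have hset (i : Fin n) : (i = x 0 ∨ i = y 0) ∧
        setPair (x 0) (y 0) t (siteOp ν, siteOp ν) i =
          setPair (x 0) (y 0) t' (siteOp ν, siteOp ν) i ∨
        (i ≠ x 0 ∧ i ≠ y 0) ∧ setPair (x 0) (y 0) t (siteOp ν, siteOp ν) i = t i ∧
          setPair (x 0) (y 0) t' (siteOp ν, siteOp ν) i = t' i := by
      by_cases h1 : i = x 0
      · subst h1
        exact Or.inl ⟨Or.inl rfl, by rw [setPair_left (hxy 0), setPair_left (hxy 0)]⟩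
      · by_cases h2 : i = y 0
        · subst h2
          exact Or.inl ⟨Or.inr rfl, by rw [setPair_right, setPair_right]⟩
        · exact Or.inr ⟨⟨h1, h2⟩, setPair_of_ne _ _ h1 h2, setPair_of_ne _ _ h1 h2⟩
    refine ih (fun k => hxy k.succ) (fun i => ?_) (fun i => ?_) (fun i => ?_)
    · rcases hset i with ⟨_, h⟩ | ⟨_, h, h'⟩
      · rw [h]
      · rw [h, h', htr]
    · rcases hset i with ⟨_, h⟩ | ⟨_, h, h'⟩
      · rw [h]
      · rw [h, h', hsw]
    · rcases hset i with ⟨_, h⟩ | ⟨⟨hx, hy⟩, h, h'⟩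
      · exact Or.inl h
      · rw [h, h']
        refine (hcov i).imp_right fun ⟨k, hk⟩ => ?_
        induction k using Fin.cases with
        -- Here `i` lies off the first pair, so the gate that covers it is a later one.
        | zero => exact absurd hk (not_or.mpr ⟨Ne.symm hx, Ne.symm hy⟩)
        | succ k => exact ⟨k, hk⟩

lemma productTensor_sum {n : ℕ} (c : Fin n → Bool → ℂ) :
    productTensor (fun i => ∑ ν, c i ν • siteOp ν) =
      ∑ γ : Config n, (∏ i, c i (γ i)) • productTensor fun i => siteOp (γ i) := by
  ext p q
  simp only [productTensor, Matrix.of_apply, Matrix.sum_apply, Matrix.smul_apply, smul_eq_mul,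
    Fintype.prod_sum, Finset.prod_mul_distrib]

lemma trace_siteOp (ν : Bool) : (siteOp ν).trace = if ν then 2 else 4 := by
  cases ν <;> simp only [siteOp, swapMatrix, Matrix.trace, Matrix.diag_apply, Matrix.of_apply,
    Matrix.one_apply, Fintype.sum_prod_type, Fin.sum_univ_two] <;> norm_num

lemma trace_siteOp_mul_swapMatrix (ν : Bool) :
    (siteOp ν * swapMatrix _).trace = if ν then 4 else 2 := by
  cases ν
  · simp only [siteOp, Matrix.one_mul]
    exact trace_siteOp true
  · simp only [siteOp, swapMatrix_mul_self]
    exact trace_siteOp false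

lemma sum_twirlCoeff_mul {n : ℕ} {x y : Fin n} (hxy : x ≠ y) (γ : Config n) (F : Config n → ℂ) :
    ∑ ν, twirlCoeff (siteOp (γ x)) (siteOp (γ y)) ν * F (setPair x y γ (ν, ν)) =
      ∑ ν : Config n, (transfer x y ν γ : ℂ) * F ν := by
  by_cases h : γ x = γ y
  · have hR : ∑ ν : Config n, (transfer x y ν γ : ℂ) * F ν = F γ := by
      simp [transfer, h, apply_ite Complex.ofReal]
    have hγ : F (setPair x y γ (γ y, γ y)) = F γ := by
      conv_rhs => rw [eq_setPair (x := x) (y := y) γ γ fun _ _ _ => rfl, h]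
    rw [hR, ← hγ, h, Fintype.sum_bool]
    -- For `I ⊗ I` the coefficients are (4·16 - 2·2)/60 = 1 and (4·4 - 16)/60 = 0; for `S ⊗ S` they
    -- are interchanged.
    cases γ y <;> simp only [twirlCoeff, trace_siteOp, trace_siteOp_mul_swapMatrix] <;> norm_num
  · refine Fintype.sum_of_injective (fun ν : Bool => setPair x y γ (ν, ν)) ?_ _ _ ?_ ?_
    · exact (setPair_injective hxy γ).comp fun a b hab => (Prod.ext_iff.mp hab).1
    · intro ν hν
      have : ¬ (ν x = ν y ∧ ∀ z, z ≠ x → z ≠ y → γ z = ν z) := by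
        rintro ⟨h1, h2⟩
        refine hν ⟨ν y, ?_⟩
        conv_rhs => rw [eq_setPair γ ν h2, h1]
      simp [transfer, h, this]
    · intro ν
      have h2 : ∀ z, z ≠ x → z ≠ y → γ z = setPair x y γ (ν, ν) z := fun z hx hy =>
        (setPair_of_ne γ _ hx hy).symm
      have h3 : setPair x y γ (ν, ν) x = setPair x y γ (ν, ν) y := by
        rw [setPair_left hxy, setPair_right]
      have h4 : transfer x y (setPair x y γ (ν, ν)) γ = 2 / 5 := by
        rw [transfer, if_neg fun h' => h h'.1, if_pos ⟨h, h3, h2⟩]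
      rw [h4]
      congr 1
      -- For one `I` and one `S` both traces equal 8, so either coefficient is (4·8 - 8)/60 = 2/5.
      revert h
      cases γ x <;> cases γ y <;> cases ν <;>
        simp only [twirlCoeff, trace_siteOp, trace_siteOp_mul_swapMatrix] <;> norm_num

lemma map_circuitChannel_siteOp {n s : ℕ} {x y : Fin s → Fin n} (hxy : ∀ k, x k ≠ y k)
    (Λ : DoubleMatrix n →ₗ[ℂ] ℂ) (γ : Config n) :
    Λ (circuitChannel x y (productTensor fun i => siteOp (γ i))) =
      ∑ δ : Fin s → Config n,
        Λ (productTensor fun i => siteOp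
          ((Fin.cons γ δ : Fin (s + 1) → Config n) (Fin.last s) i)) *
          ∏ k, (transfer (x k) (y k) ((Fin.cons γ δ : Fin (s + 1) → Config n) k.succ)
            ((Fin.cons γ δ : Fin (s + 1) → Config n) k.castSucc) : ℂ) := by
  induction s generalizing γ with
  | zero => simp [circuitChannel]
  | succ s ih =>
    rw [← (Fin.consEquiv fun _ : Fin (s + 1) => Config n).sum_comp, Fintype.sum_prod_type]
    have hg (γ₁ : Config n) (δ : Fin s → Config n) :
        (Fin.consEquiv fun _ : Fin (s + 1) => Config n) (γ₁, δ) = Fin.cons γ₁ δ := rfl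
    have ih' := fun ν => ih (x := Fin.tail x) (y := Fin.tail y) (fun k => hxy k.succ) ν
    simp only [circuitChannel, LinearMap.comp_apply, gateChannel_productTensor (hxy 0), map_sum,
      map_smul, smul_eq_mul]
    simp only [← setPair_comp siteOp γ (_, _)]
    rw [sum_twirlCoeff_mul (hxy 0) γ fun ν =>
      Λ (circuitChannel (Fin.tail x) (Fin.tail y) (productTensor fun i => siteOp (ν i)))]
    refine Finset.sum_congr rfl fun γ₁ _ => ?_
    rw [ih', Finset.mul_sum]
    refine Finset.sum_congr rfl fun δ _ => ?_
    rw [hg, Fin.prod_univ_succ, ← Fin.succ_last]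
    simp only [Fin.cons_succ, Fin.castSucc_zero, Fin.cons_zero, Fin.castSucc_succ, Fin.tail]
    ring

/-! ### The quadratic form as a functional on two copies -/

/-- The linear functional on two copies whose value at `A ⊗ B` is `tr (P (1 ⊗ A) P (1 ⊗ B))`. -/
def pairing {α β : Type*} [Fintype α] [Fintype β] (P : Matrix (β × α) (β × α) ℂ) :
    Matrix (α × α) (α × α) ℂ →ₗ[ℂ] ℂ where
  toFun T := ∑ i, ∑ s, ∑ s', ∑ j, ∑ t', ∑ t, P (i, s) (j, t) * P (j, t') (i, s') * T (t, s') (t', s)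
  map_add' T T' := by
    simp only [Matrix.add_apply, mul_add, Finset.sum_add_distrib]
  map_smul' c T := by
    simp only [Matrix.smul_apply, smul_eq_mul, RingHom.id_apply, Finset.mul_sum]
    refine Finset.sum_congr rfl fun _ _ => Finset.sum_congr rfl fun _ _ =>
      Finset.sum_congr rfl fun _ _ => Finset.sum_congr rfl fun _ _ =>
      Finset.sum_congr rfl fun _ _ => Finset.sum_congr rfl fun _ _ => ?_
    ring

section Pairing

variable {α β : Type*} [Fintype α] [DecidableEq α] [Fintype β] [DecidableEq β]
  (P : Matrix (β × α) (β × α) ℂ)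

omit [DecidableEq α] in
lemma trace_eq_pairing (A B : Matrix α α ℂ) :
    (P * ((1 : Matrix β β ℂ) ⊗ₖ A) * P * ((1 : Matrix β β ℂ) ⊗ₖ B)).trace = pairing P (A ⊗ₖ B) := by
  have hmul (X : Matrix (β × α) (β × α) ℂ) (A : Matrix α α ℂ) (p : β × α) (j : β) (t : α) :
      (X * ((1 : Matrix β β ℂ) ⊗ₖ A)) p (j, t) = ∑ s, X p (j, s) * A s t := by
    simp [Matrix.mul_apply, Fintype.sum_prod_type, Matrix.one_apply]
  simp only [Matrix.trace, Matrix.diag_apply, Fintype.sum_prod_type, hmul]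
  simp only [Matrix.mul_apply (N := P), Fintype.sum_prod_type, hmul, Finset.sum_mul]
  simp only [pairing, LinearMap.coe_mk, AddHom.coe_mk, Matrix.kroneckerMap_apply]
  refine Finset.sum_congr rfl fun _ _ => Finset.sum_congr rfl fun _ _ =>
    Finset.sum_congr rfl fun _ _ => Finset.sum_congr rfl fun _ _ =>
    Finset.sum_congr rfl fun _ _ => Finset.sum_congr rfl fun _ _ => ?_
  ring

omit [DecidableEq β] in
lemma pairing_one : pairing P 1 = (P * P).trace := by
  simp [pairing, Matrix.one_apply, Matrix.trace, Matrix.mul_apply, Fintype.sum_prod_type, ite_and]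

omit [DecidableEq β] in
lemma pairing_swapMatrix :
    pairing P (swapMatrix α) = (ptraceSnd P * ptraceSnd P).trace := by
  simp only [pairing, LinearMap.coe_mk, AddHom.coe_mk, swapMatrix, Matrix.of_apply, ite_and,
    mul_ite, mul_one, mul_zero, Finset.sum_ite_eq, Finset.sum_ite_eq', Finset.mem_univ, if_true,
    Matrix.trace, Matrix.diag_apply, Matrix.mul_apply, ptraceSnd, Finset.sum_mul_sum]
  refine Finset.sum_congr rfl fun i _ => ?_
  rw [Finset.sum_congr rfl fun s _ => Finset.sum_comm, Finset.sum_comm]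

omit [DecidableEq α] [DecidableEq β] in
lemma pairing_sitePower {n : ℕ} (P : Matrix (β × Fin 2) (β × Fin 2) ℂ) (t : Fin n → SiteMatrix) :
    pairing (sitePower n P) (productTensor t) = ∏ i, pairing P (t i) := by
  simp only [pairing, sitePower, productTensor, LinearMap.coe_mk, AddHom.coe_mk, Matrix.of_apply,
    ← Finset.prod_mul_distrib]
  -- The same identity at two universe levels: `h` serves the sums over `β`, `h'` those over `Fin
  -- 2`.
  have h {κ : Type _} [Fintype κ] (f : Fin n → κ → ℂ) :
      ∑ x : Fin n → κ, ∏ i, f i (x i) = ∏ i, ∑ j, f i j := (Fintype.prod_sum f).symm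
  have h' {κ : Type} [Fintype κ] (f : Fin n → κ → ℂ) :
      ∑ x : Fin n → κ, ∏ i, f i (x i) = ∏ i, ∑ j, f i j := (Fintype.prod_sum f).symm
  symm
  rw [← h]
  refine Finset.sum_congr rfl fun _ _ => ?_
  rw [← h']
  refine Finset.sum_congr rfl fun _ _ => ?_
  rw [← h']
  refine Finset.sum_congr rfl fun _ _ => ?_
  rw [← h]
  refine Finset.sum_congr rfl fun _ _ => ?_
  rw [← h']
  refine Finset.sum_congr rfl fun _ _ => ?_
  rw [← h']

end Pairing

/-! ### The initial state -/

/-- The block of a matrix on `S ⊗ R` at given indices of `R`. -/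
def block {σ r : Type*} (X : Matrix (σ × r) (σ × r) ℂ) (i j : r) : Matrix σ σ ℂ :=
  Matrix.of fun s s' => X (s, i) (s', j)

lemma trace_tensorId_sq {σ ε r : Type*} [Fintype ε] [DecidableEq ε] [Fintype r] [DecidableEq r]
    (Φ : Matrix σ σ ℂ →ₗ[ℂ] Matrix ε ε ℂ) (X : Matrix (σ × r) (σ × r) ℂ) :
    ((tensorId Φ X) ^ 2).trace = ∑ i, ∑ j, (Φ (block X i j) * Φ (block X j i)).trace := by
  simp only [sq, Matrix.trace, Matrix.diag_apply, Matrix.mul_apply, Fintype.sum_prod_type,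
    tensorId, Matrix.of_apply]
  rw [Finset.sum_comm]
  refine Finset.sum_congr rfl fun i _ => ?_
  rw [Finset.sum_congr rfl fun e _ => Finset.sum_comm, Finset.sum_comm]
  rfl

lemma block_conjMap {σ r : Type*} [Fintype σ] [Fintype r] [DecidableEq r] (U : Matrix σ σ ℂ)
    (X : Matrix (σ × r) (σ × r) ℂ) (i j : r) :
    block (conjMap (U ⊗ₖ (1 : Matrix r r ℂ)) X) i j = U * block X i j * Uᴴ := by
  ext s s'
  simp [block, conjMap, Matrix.mul_apply, Fintype.sum_prod_type, Matrix.one_apply,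
    apply_ite (starRingEnd ℂ)]

/-- The two copies of a qubit in the purity of the initial state. -/
def initialSite (a b : ℕ) {n : ℕ} (i : Fin n) : SiteMatrix :=
  if IsLogical a b i then swapMatrix (Fin 2) else Matrix.single (0, 0) (0, 0) 1

/-- Up to `1/2^k`, the block at `(r, r')` is `|r⟩⟨r'|` on `L` times the ancilla projector, and the
sum of `|r⟩⟨r'| ⊗ |r'⟩⟨r|` is the swap on the two copies of `L`. -/
lemma sum_block_initialState (a b n : ℕ) :
    ∑ r, ∑ r', block (initialState a b n) r r' ⊗ₖ block (initialState a b n) r' r =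
      ((Fintype.card (Logical a b n) : ℂ)⁻¹ ^ 2) • productTensor (initialSite a b) := by
  ext ⟨t, s'⟩ ⟨t', s⟩
  set A : Prop := ∀ i, ¬ IsLogical a b i → t i = 0 ∧ t' i = 0 with hA
  set B : Prop := ∀ i, ¬ IsLogical a b i → s' i = 0 ∧ s i = 0 with hB
  set C : Prop := (fun i : {i : Fin n // IsLogical a b i} => s' i) =
    (fun i : {i : Fin n // IsLogical a b i} => t' i) with hC
  set C' : Prop := (fun i : {i : Fin n // IsLogical a b i} => s i) =
    (fun i : {i : Fin n // IsLogical a b i} => t i) with hC'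
  have hprod : productTensor (initialSite a b (n := n)) (t, s') (t', s) =
      if A ∧ B ∧ C ∧ C' then 1 else 0 := by
    have hsite (i : Fin n) : initialSite a b i (t i, s' i) (t' i, s i) =
        if (IsLogical a b i → s' i = t' i ∧ s i = t i) ∧
          (¬ IsLogical a b i → (t i = 0 ∧ t' i = 0) ∧ s' i = 0 ∧ s i = 0) then 1 else 0 := by
      by_cases h : IsLogical a b i
      · simp only [initialSite, h, if_true, swapMatrix, Matrix.of_apply]
        exact if_congr (by grind) rfl rfl
      · simp only [initialSite, h, if_false, Matrix.single_apply, not_false_eq_true, forall_const,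
          false_imp_iff, true_and, Prod.mk.injEq]
        exact if_congr (by grind) rfl rfl
    simp only [productTensor, Matrix.of_apply, hsite]
    have hiff : (∀ i, (IsLogical a b i → s' i = t' i ∧ s i = t i) ∧
        (¬ IsLogical a b i → (t i = 0 ∧ t' i = 0) ∧ s' i = 0 ∧ s i = 0)) ↔ A ∧ B ∧ C ∧ C' := by
      simp only [hA, hB, hC, hC', funext_iff, Subtype.forall]
      grind
    by_cases H : A ∧ B ∧ C ∧ C'
    · rw [if_pos H]
      exact Finset.prod_eq_one fun i _ => if_pos (hiff.mpr H i)
    · rw [if_neg H]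
      obtain ⟨i, hi⟩ := not_forall.mp fun h => H (hiff.mp h)
      exact Finset.prod_eq_zero (Finset.mem_univ i) (if_neg hi)
  simp only [Matrix.sum_apply, Matrix.kroneckerMap_apply, block, Matrix.of_apply, initialState,
    maxEntangled, Matrix.smul_apply, hprod, smul_eq_mul]
  have hterm (r r' : Logical a b n) :
      ((if (fun i : {i : Fin n // IsLogical a b i} => t i) = r ∧
          (fun i : {i : Fin n // IsLogical a b i} => t' i) = r'
          then (Fintype.card (Logical a b n) : ℂ)⁻¹ else 0) *
        (if A then 1 else 0) *
        ((if (fun i : {i : Fin n // IsLogical a b i} => s' i) = r' ∧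
          (fun i : {i : Fin n // IsLogical a b i} => s i) = r
          then (Fintype.card (Logical a b n) : ℂ)⁻¹ else 0) *
        (if B then 1 else 0))) =
      if (fun i : {i : Fin n // IsLogical a b i} => t' i) = r' then
        if (fun i : {i : Fin n // IsLogical a b i} => t i) = r then
          (Fintype.card (Logical a b n) : ℂ)⁻¹ ^ 2 * (if A ∧ B ∧ C ∧ C' then 1 else 0)
        else 0 else 0 := by
    by_cases h1 : (fun i : {i : Fin n // IsLogical a b i} => t i) = r
    swap
    · simp [h1]
    by_cases h2 : (fun i : {i : Fin n // IsLogical a b i} => t' i) = r'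
    swap
    · simp [h2]
    subst h1 h2
    simp only [← hC, ← hC']
    by_cases h3 : A <;> by_cases h4 : B <;> by_cases h5 : C <;> by_cases h6 : C' <;>
      simp only [h3, h4, h5, h6, and_self, and_true, and_false, if_true, if_false, mul_zero,
        zero_mul, mul_one, sq]
  refine (Finset.sum_congr rfl fun r _ => Finset.sum_congr rfl fun r' _ =>
    Eq.trans ?_ (hterm r r')).trans ?_
  · congr
  simp only [Finset.sum_ite_eq, Finset.mem_univ, if_true]

lemma card_isLogical {a b m : ℕ} (hab : a ≤ b) :
    Fintype.card {i : Fin (b * m) // IsLogical a b i} = a * m := by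
  have hcount (m : ℕ) : Nat.count (fun i => i % b < a) (b * m) = a * m := by
    induction m with
    | zero => simp
    | succ m ih =>
      rw [Nat.mul_succ, Nat.count_add, ih, Nat.mul_succ]
      simp only [Nat.mul_add_mod]
      congr 1
      rw [Nat.count_eq_card_filter_range]
      have : Finset.filter (fun i => i % b < a) (Finset.range b) = Finset.range a := by
        ext i
        simp only [Finset.mem_filter, Finset.mem_range]
        constructor
        · rintro ⟨h1, h2⟩
          rwa [Nat.mod_eq_of_lt h1] at h2
        · intro h
          have h1 := h.trans_le hab
          exact ⟨h1, by rwa [Nat.mod_eq_of_lt h1]⟩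
      rw [this, Finset.card_range]
  rw [← hcount, Nat.count_eq_card_filter_range, Fintype.card_subtype, Finset.card_filter,
    Finset.card_filter, ← Fin.sum_univ_eq_sum_range (fun i => if i % b < a then 1 else 0)]
  rfl

lemma card_logical {a b m : ℕ} (hab : a ≤ b) :
    Fintype.card (Logical a b (b * m)) = 2 ^ (a * m) := by
  rw [Fintype.card_fun, card_isLogical hab, Fintype.card_fin]

/-- The coefficients of `I` and `S` in the local twirl of the initial state. -/
def initialCoeff (a b : ℕ) {n : ℕ} (i : Fin n) (ν : Bool) : ℂ :=
  if IsLogical a b i then (if ν then 1 else 0) else 6⁻¹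

/-- `|00⟩⟨00|` has trace 1 both alone and against `S`; `(I + S)/6` matches this since (4 + 2)/6 = 1.
Logical sites already carry `S`. -/
lemma trace_initialSite (a b : ℕ) {n : ℕ} (i : Fin n) :
    (initialSite a b i).trace = (∑ ν, initialCoeff a b i ν • siteOp ν).trace ∧
    (initialSite a b i * swapMatrix _).trace =
      ((∑ ν, initialCoeff a b i ν • siteOp ν) * swapMatrix _).trace := by
  rw [Fintype.sum_bool, Matrix.add_mul, Matrix.smul_mul, Matrix.smul_mul, Matrix.trace_add,
    Matrix.trace_add, Matrix.trace_smul, Matrix.trace_smul, Matrix.trace_smul, Matrix.trace_smul,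
    trace_siteOp, trace_siteOp, trace_siteOp_mul_swapMatrix, trace_siteOp_mul_swapMatrix]
  by_cases h : IsLogical a b i
  · simp only [initialSite, initialCoeff, h, if_true]
    have h1 := trace_siteOp true
    have h2 := trace_siteOp_mul_swapMatrix true
    simp only [siteOp] at h1 h2
    simp [h1, h2]
  · simp only [initialSite, initialCoeff, h, if_false]
    constructor
    · simp; norm_num
    · simp [Matrix.trace, Matrix.mul_apply, Matrix.single_apply, swapMatrix, ite_and,
        Fintype.sum_prod_type]
      norm_num

lemma prod_initialCoeff {a b m : ℕ} (hab : a ≤ b) (γ : Config (b * m)) :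
    ∏ i, initialCoeff a b i (γ i) =
      if ∀ i, IsLogical a b i → γ i = true then (6⁻¹ : ℂ) ^ (b * m - a * m) else 0 := by
  have hcard : (Finset.univ.filter fun i : Fin (b * m) => ¬ IsLogical a b i).card =
      b * m - a * m := by
    rw [← Fintype.card_subtype, Fintype.card_subtype_compl, Fintype.card_fin, card_isLogical hab]
  simp only [initialCoeff]
  rw [Finset.prod_ite, Finset.prod_const, hcard, Finset.prod_boole, ite_mul, one_mul, zero_mul]
  simp

/-! ### The geometry of the brickwork circuit -/

/-- A collision forces `x + 1` to wrap around to `x`, that is `n = 1`, which is odd. -/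
lemma leftQubit_ne_rightQubit {n D : ℕ} (hn : Even n) (t : Fin (gateCount n D)) :
    leftQubit t ≠ rightQubit t := by
  have h0 := pos_of_gate t
  intro h
  have h1 : (leftQubit t : ℕ) = ((leftQubit t : ℕ) + 1) % n := congrArg Fin.val h
  have h2 := (leftQubit t).2
  obtain ⟨k, hk⟩ := hn
  rcases (Nat.succ_le_of_lt h2).eq_or_lt with h3 | h3
  · rw [show (leftQubit t : ℕ) + 1 = n from h3, Nat.mod_self] at h1
    omega
  · rw [Nat.mod_eq_of_lt h3] at h1
    omega

/-- Gate number `i / 2` of the first layer acts on `{2 (i / 2), 2 (i / 2) + 1}`; this layer is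
present because `D ≥ 1`. -/
lemma exists_gate {n D : ℕ} (hn : Even n) (hD : 1 ≤ D) (i : Fin n) :
    ∃ t : Fin (gateCount n D), leftQubit t = i ∨ rightQubit t = i := by
  obtain ⟨k, hk⟩ := hn
  have hi := i.2
  have h1 : (i : ℕ) / 2 < n / 2 := by omega
  have h2 : n / 2 ≤ gateCount n D := Nat.le_mul_of_pos_right _ hD
  refine ⟨⟨i / 2, h1.trans_le h2⟩, ?_⟩
  have hl : ((leftQubit (⟨i / 2, h1.trans_le h2⟩ : Fin (gateCount n D)) : Fin n) : ℕ) =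
      2 * (i / 2) := by
    simp only [leftQubit]
    rw [Nat.mod_eq_of_lt h1, Nat.div_eq_of_lt h1, Nat.zero_mod, add_zero, Nat.mod_eq_of_lt]
    omega
  rcases Nat.even_or_odd' (i : ℕ) with ⟨j, hj | hj⟩
  · exact Or.inl (Fin.ext (hl.trans (by omega)))
  · refine Or.inr (Fin.ext ?_)
    simp only [rightQubit, hl]
    rw [Nat.mod_eq_of_lt] <;> omega

/-! ### The partition function -/

/-- The noise enters only through `tr C = 2` and tr((tr₂ P)²) = 2λ, the values of the one-site
functional at `I` and `S`, so both noise models are instances. -/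
lemma partitionFunction_eq {β E : Type*} [Fintype β] [DecidableEq β] [Fintype E] [DecidableEq E]
    {a b m D : ℕ} (hab : a ≤ b) (hn : Even (b * m)) (hD : 1 ≤ D)
    {N : Matrix (Fin 2) (Fin 2) ℂ →ₗ[ℂ] Matrix β β ℂ} {P : Matrix (β × Fin 2) (β × Fin 2) ℂ}
    (hP : open scoped ComplexOrder in P.PosSemidef) (hPN : P * P = choi N)
    (htr : (choi N).trace = 2) {lam : ℝ}
    (hlam : (ptraceSnd P * ptraceSnd P).trace = 2 * lam)
    {V : Matrix ((Fin (b * m) → β) × E) (Fin (b * m) → Fin 2) ℂ}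
    (hV : IsStinespring (tensorPower (b * m) N) V) :
    partitionFunction a b m D V =
      ((3 ^ (a * m) * (2 ^ (b * m) / 3 ^ (b * m)) * trajectorySum a b m D lam : ℝ) : ℂ) := by
  set x : Fin (gateCount (b * m) D) → Fin (b * m) := leftQubit with hx
  set y : Fin (gateCount (b * m) D) → Fin (b * m) := rightQubit with hy
  have hxy : ∀ k, x k ≠ y k := leftQubit_ne_rightQubit hn
  set Λ : DoubleMatrix (b * m) →ₗ[ℂ] ℂ := pairing (sitePower (b * m) P) with hΛ
  have hF (U : Matrix (Qubits (b * m)) (Qubits (b * m)) ℂ) :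
      ((tensorId (normalizedMap (complementaryChannel V))
        (conjMap (U ⊗ₖ (1 : Matrix (Logical a b (b * m)) (Logical a b (b * m)) ℂ))
          (initialState a b (b * m)))) ^ 2).trace =
      2 ^ (b * m) * (((2 : ℂ) ^ (a * m))⁻¹ ^ 2 *
        Λ (conjMap (U ⊗ₖ U) (productTensor (initialSite a b)))) := by
    have hsum := sum_block_initialState a b (b * m)
    rw [card_logical hab] at hsum
    have h1 := trace_normalizedMap_mul hV (sitePower_posSemidef (b * m) hP)
      (by rw [sitePower_mul, hPN, choi_tensorPower])
    rw [trace_tensorId_sq]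
    simp only [block_conjMap, h1, trace_eq_pairing, ← conjMap_kronecker, ← Finset.mul_sum,
      ← map_sum]
    rw [hsum, map_smul, map_smul, hΛ]
    simp
  have hsite (γ : Config (b * m)) : Λ (productTensor fun i => siteOp (γ i)) = 2 ^ (b * m) * lam ^ countS γ := by
    have h1 (ν : Bool) : pairing P (siteOp ν) = 2 * if ν = true then (lam : ℂ) else 1 := by
      cases ν
      · simp [siteOp, pairing_one, hPN, htr]
      · simp [siteOp, pairing_swapMatrix, hlam]
    rw [hΛ, pairing_sitePower]
    simp only [h1]
    rw [Finset.prod_mul_distrib, Finset.prod_const, Finset.card_univ, Fintype.card_fin,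
      Finset.prod_ite, Finset.prod_const, Finset.prod_const_one, mul_one, countS]
  have hexp : brickworkExpect (b * m) D (fun U => ((tensorId (normalizedMap (complementaryChannel V))
        (conjMap (U ⊗ₖ (1 : Matrix (Logical a b (b * m)) (Logical a b (b * m)) ℂ))
          (initialState a b (b * m)))) ^ 2).trace) =
      2 ^ (b * m) * (((2 : ℂ) ^ (a * m))⁻¹ ^ 2 *
        Λ (circuitChannel x y (productTensor (initialSite a b)))) := by
    simp only [brickworkExpect, hF, ← Finset.mul_sum, ← map_sum]
    have := sum_conjMap_circuitMatrix x y (productTensor (initialSite a b))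
    rw [show (∑ g : Fin (gateCount (b * m) D) → CliffordGate,
      conjMap (circuit g ⊗ₖ circuit g) (productTensor (initialSite a b))) = _ from this,
      map_smul, Fintype.card_fun, Fintype.card_fin, smul_eq_mul]
    have hc := pow_ne_zero (gateCount (b * m) D) card_cliffordGate_ne_zero
    push_cast
    field_simp
  have hinit : Λ (circuitChannel x y (productTensor (initialSite a b))) =
      (6⁻¹ : ℂ) ^ (b * m - a * m) * (2 ^ (b * m) * trajectorySum a b m D lam) := by
    rw [circuitChannel_congr hxy (fun i => (trace_initialSite a b i).1)
      (fun i => (trace_initialSite a b i).2) (fun i => Or.inr (exists_gate hn hD i)),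
      productTensor_sum, map_sum, map_sum]
    simp only [map_smul, smul_eq_mul, map_circuitChannel_siteOp hxy, hsite, prod_initialCoeff hab]
    rw [trajectorySum, Finset.sum_filter,
      ← (Fin.consEquiv fun _ : Fin (gateCount (b * m) D + 1) => Config (b * m)).sum_comp,
      Fintype.sum_prod_type]
    push_cast
    simp only [Finset.mul_sum]
    refine Finset.sum_congr rfl fun γ _ => Finset.sum_congr rfl fun δ _ => ?_
    have hg : (Fin.consEquiv fun _ : Fin (gateCount (b * m) D + 1) => Config (b * m)) (γ, δ) =
      Fin.cons γ δ := rfl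
    simp only [hg, Fin.cons_zero]
    split_ifs
    · push_cast
      ring
    · simp
  rw [partitionFunction, hexp, hinit]
  have hk : a * m ≤ b * m := Nat.mul_le_mul_right m hab
  -- With `n = k + l` the truncated subtraction disappears. The constants are 2^k · 2^n · 4^(-k) ·
  -- 6^(-l) · 2^n = 3^k · 2^n / 3^n.
  obtain ⟨l, hl⟩ := Nat.exists_eq_add_of_le hk
  rw [hl, Nat.add_sub_cancel_left]
  push_cast
  rw [show (6 : ℂ) = 2 * 3 by norm_num]
  simp only [pow_add, mul_pow, inv_pow]
  field_simp

/-! ### Pauli noise -/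

open scoped ComplexOrder in
lemma posSemidef_ofReal_smul {κ : Type*} {A : Matrix κ κ ℂ} (hA : A.PosSemidef) {c : ℝ}
    (hc : 0 ≤ c) : ((c : ℂ) • A).PosSemidef :=
  hA.smul (by exact_mod_cast hc)

/-- The conjugate of a Pauli matrix as a vector. -/
def pauliVec (l : Fin 4) : Fin 2 × Fin 2 → ℂ := fun q => star (pauli l q.1 q.2)

lemma star_pauliVec_dotProduct (l l' : Fin 4) :
    star (pauliVec l) ⬝ᵥ pauliVec l' = if l = l' then 2 else 0 := by
  rw [← trace_pauli_mul]
  nth_rw 1 [← pauli_conjTranspose l']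
  simp [dotProduct, pauliVec, Matrix.trace, Matrix.mul_apply, Fintype.sum_prod_type]

/-- The square root of the Choi matrix of Pauli noise. -/
def pauliRoot (p : Fin 4 → ℝ) : Matrix (Fin 2 × Fin 2) (Fin 2 × Fin 2) ℂ :=
  ∑ l, ((Real.sqrt (p l / 2) : ℝ) : ℂ) • Matrix.vecMulVec (pauliVec l) (star (pauliVec l))

open scoped ComplexOrder in
lemma pauliRoot_posSemidef (p : Fin 4 → ℝ) : (pauliRoot p).PosSemidef :=
  Matrix.posSemidef_sum _ fun _ _ => posSemidef_ofReal_smul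
    (Matrix.posSemidef_vecMulVec_self_star _) (Real.sqrt_nonneg _)

lemma choi_pauliNoise (p : Fin 4 → ℝ) : choi (pauliNoise p) =
    ∑ l, (p l : ℂ) • Matrix.vecMulVec (pauliVec l) (star (pauliVec l)) := by
  ext ⟨i, s⟩ ⟨j, t⟩
  simp only [choi, pauliNoise, Matrix.of_apply, LinearMap.sum_apply, LinearMap.smul_apply,
    Matrix.sum_apply, Matrix.smul_apply, conjMap, LinearMap.coe_mk, AddHom.coe_mk,
    Matrix.vecMulVec_apply, pauliVec, Pi.star_apply]
  refine Finset.sum_congr rfl fun l _ => ?_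
  simp [Matrix.mul_apply, Matrix.single_apply, ite_and, mul_comm]

/-- The vectorized Paulis are orthogonal with squared norm 2; the `1/2` under the root compensates
for this norm. -/
lemma pauliRoot_mul_self {p : Fin 4 → ℝ} (hp : ∀ j, 0 ≤ p j) :
    pauliRoot p * pauliRoot p = choi (pauliNoise p) := by
  have hmul (l l' : Fin 4) : Matrix.vecMulVec (pauliVec l) (star (pauliVec l)) *
      Matrix.vecMulVec (pauliVec l') (star (pauliVec l')) =
        if l = l' then (2 : ℂ) • Matrix.vecMulVec (pauliVec l) (star (pauliVec l)) else 0 := by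
    rw [Matrix.vecMulVec_mul_vecMulVec, star_pauliVec_dotProduct]
    split_ifs with h
    · rw [h, Matrix.vecMulVec_smul]
    · rw [zero_smul, Matrix.vecMulVec_zero]
  rw [choi_pauliNoise, pauliRoot, Finset.sum_mul_sum]
  refine Finset.sum_congr rfl fun l _ => ?_
  simp only [Matrix.smul_mul, Matrix.mul_smul, hmul, smul_ite, smul_zero, Finset.sum_ite_eq,
    Finset.mem_univ, if_true, smul_smul]
  congr 1
  rw [← mul_assoc, ← Complex.ofReal_mul, Real.mul_self_sqrt (by have := hp l; positivity)]
  push_cast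
  ring

lemma trace_choi_pauliNoise {p : Fin 4 → ℝ} (hp : ∑ j, p j = 1) :
    (choi (pauliNoise p)).trace = 2 := by
  rw [choi_pauliNoise, Matrix.trace_sum]
  have h (l : Fin 4) : (Matrix.vecMulVec (pauliVec l) (star (pauliVec l))).trace = 2 := by
    rw [Matrix.trace_vecMulVec, dotProduct_comm, star_pauliVec_dotProduct, if_pos rfl]
  simp only [Matrix.trace_smul, h, smul_eq_mul]
  rw [← Finset.sum_mul, ← Complex.ofReal_sum, hp]
  simp

lemma ptraceSnd_pauliRoot (p : Fin 4 → ℝ) :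
    ptraceSnd (pauliRoot p) = ((∑ l, Real.sqrt (p l / 2) : ℝ) : ℂ) • 1 := by
  have h (l : Fin 4) (i j : Fin 2) :
      ∑ s, pauliVec l (i, s) * star (pauliVec l (j, s)) = (1 : Matrix (Fin 2) (Fin 2) ℂ) i j := by
    fin_cases l <;> fin_cases i <;> fin_cases j <;> simp [pauliVec, pauli, Matrix.one_apply]
  ext i j
  simp only [ptraceSnd, pauliRoot, Matrix.of_apply, Matrix.sum_apply, Matrix.smul_apply,
    Matrix.vecMulVec_apply, Pi.star_apply, smul_eq_mul]
  rw [Finset.sum_comm, Complex.ofReal_sum, Finset.sum_mul]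
  refine Finset.sum_congr rfl fun l _ => ?_
  rw [← Finset.mul_sum, h]

lemma two_mul_rpow_pauliStrength_sub_one {p : Fin 4 → ℝ} (hp : ∀ j, 0 ≤ p j)
    (hp1 : ∑ j, p j = 1) :
    2 * (2 : ℝ) ^ (pauliStrength p - 1) = (∑ j, Real.sqrt (p j)) ^ 2 := by
  -- `2 ^ logb 2 x = x` needs `x > 0`; normalization excludes that all `p j` vanish.
  have hpos : 0 < ∑ j, Real.sqrt (p j) := by
    refine (Finset.sum_nonneg fun j _ => Real.sqrt_nonneg (p j)).lt_of_ne fun h => ?_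
    have h0 := (Finset.sum_eq_zero_iff_of_nonneg fun j _ => Real.sqrt_nonneg (p j)).mp h.symm
    have : ∑ j, p j = 0 := Finset.sum_eq_zero fun j hj =>
      (Real.sqrt_eq_zero (hp j)).mp (h0 j hj)
    rw [hp1] at this
    exact one_ne_zero this
  rw [Real.rpow_sub two_pos, Real.rpow_one, pauliStrength, mul_comm (2 : ℝ) (Real.logb _ _),
    Real.rpow_mul two_pos.le, Real.rpow_logb two_pos (by norm_num) hpos, Real.rpow_two]
  ring

lemma trace_ptraceSnd_pauliRoot {p : Fin 4 → ℝ} (hp : ∀ j, 0 ≤ p j) (hp1 : ∑ j, p j = 1) :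
    (ptraceSnd (pauliRoot p) * ptraceSnd (pauliRoot p)).trace =
      2 * ((2 ^ (pauliStrength p - 1) : ℝ) : ℂ) := by
  have h : ∑ l, Real.sqrt (p l / 2) = (∑ l, Real.sqrt (p l)) / Real.sqrt 2 := by
    rw [Finset.sum_div]
    exact Finset.sum_congr rfl fun l _ => Real.sqrt_div (hp l) 2
  have h2 : (∑ l, Real.sqrt (p l / 2)) * (∑ l, Real.sqrt (p l / 2)) * 2 =
      2 * 2 ^ (pauliStrength p - 1) := by
    rw [two_mul_rpow_pauliStrength_sub_one hp hp1, h, div_mul_div_comm,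
      Real.mul_self_sqrt two_pos.le]
    ring
  rw [ptraceSnd_pauliRoot, Matrix.smul_mul, Matrix.mul_smul, Matrix.mul_one, Matrix.trace_smul,
    Matrix.trace_smul, Matrix.trace_one, Fintype.card_fin, smul_eq_mul, smul_eq_mul, ← mul_assoc]
  exact_mod_cast h2

/-! ### Erasure noise -/

/-- The inclusion of a qubit into a qutrit as a vector. -/
def inclusionVec : Fin 3 × Fin 2 → ℂ := fun q => qubitInclusion q.1 q.2

/-- The projection onto the extra state of the qutrit. -/
def erasedProjection : Matrix (Fin 3 × Fin 2) (Fin 3 × Fin 2) ℂ :=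
  Matrix.diagonal fun q => if q.1 = 2 then 1 else 0

/-- The square root of the Choi matrix of erasure noise. -/
def erasureRoot (p : ℝ) : Matrix (Fin 3 × Fin 2) (Fin 3 × Fin 2) ℂ :=
  ((Real.sqrt ((1 - p) / 2) : ℝ) : ℂ) • Matrix.vecMulVec inclusionVec (star inclusionVec) +
    ((Real.sqrt p : ℝ) : ℂ) • erasedProjection

open scoped ComplexOrder in
lemma erasureRoot_posSemidef (p : ℝ) : (erasureRoot p).PosSemidef := by
  refine (posSemidef_ofReal_smul (Matrix.posSemidef_vecMulVec_self_star _)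
    (Real.sqrt_nonneg _)).add (posSemidef_ofReal_smul ?_ (Real.sqrt_nonneg _))
  refine Matrix.PosSemidef.diagonal fun q => ?_
  dsimp only
  split_ifs <;> simp

lemma choi_erasureNoise (p : ℝ) : choi (erasureNoise p) =
    ((1 - p : ℝ) : ℂ) • Matrix.vecMulVec inclusionVec (star inclusionVec) +
      (p : ℂ) • erasedProjection := by
  ext ⟨i, s⟩ ⟨j, t⟩
  have h : conjMap qubitInclusion (Matrix.single t s 1) j i =
      qubitInclusion j t * star (qubitInclusion i s) := by
    simp [conjMap, Matrix.mul_apply, Matrix.single_apply, ite_and]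
  simp only [choi, erasureNoise, Matrix.of_apply, LinearMap.add_apply, LinearMap.smul_apply,
    Matrix.add_apply, Matrix.smul_apply, h]
  fin_cases i <;> fin_cases s <;> fin_cases j <;> fin_cases t <;>
  simp [Matrix.vecMulVec_apply, inclusionVec, qubitInclusion,
    erasedProjection]

lemma star_inclusionVec_dotProduct : star inclusionVec ⬝ᵥ inclusionVec = 2 := by
  simp [dotProduct, inclusionVec, qubitInclusion, Fintype.sum_prod_type, Fin.sum_univ_three]
  norm_num

/-- The two terms have orthogonal supports, since the included qubit never reaches `|2⟩`. The
inclusion vector has squared norm 2, whence `(1 - p) / 2`. -/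
lemma erasureRoot_mul_self {p : ℝ} (h0 : 0 ≤ p) (h1 : p ≤ 1) :
    erasureRoot p * erasureRoot p = choi (erasureNoise p) := by
  have hD : erasedProjection * erasedProjection = erasedProjection := by
    rw [erasedProjection, Matrix.diagonal_mul_diagonal]
    congr 1
    funext q
    simp
  have hl : erasedProjection * Matrix.vecMulVec inclusionVec (star inclusionVec) = 0 := by
    ext ⟨i, s⟩ q
    rw [erasedProjection, Matrix.diagonal_mul]
    fin_cases i <;> fin_cases s <;> simp [Matrix.vecMulVec_apply, inclusionVec, qubitInclusion]
  have hr : Matrix.vecMulVec inclusionVec (star inclusionVec) * erasedProjection = 0 := by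
    ext q ⟨i, s⟩
    rw [erasedProjection, Matrix.mul_diagonal]
    fin_cases i <;> fin_cases s <;> simp [Matrix.vecMulVec_apply, inclusionVec, qubitInclusion]
  have hs1 := Real.mul_self_sqrt (show 0 ≤ (1 - p) / 2 by linarith)
  have hs2 := Real.mul_self_sqrt h0
  rw [choi_erasureNoise, erasureRoot]
  simp only [Matrix.add_mul, Matrix.mul_add, Matrix.smul_mul, Matrix.mul_smul, hD, hl, hr,
    Matrix.vecMulVec_mul_vecMulVec, star_inclusionVec_dotProduct, smul_zero, add_zero, zero_add,
    smul_smul, Matrix.vecMulVec_smul]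
  rw [← mul_assoc, ← Complex.ofReal_mul, ← Complex.ofReal_mul, hs1, hs2]
  congr 2
  push_cast
  ring

lemma trace_choi_erasureNoise (p : ℝ) : (choi (erasureNoise p)).trace = 2 := by
  have h : erasedProjection.trace = 2 := by
    simp only [erasedProjection, Matrix.trace_diagonal, Fintype.sum_prod_type,
      Fin.sum_univ_three, Fin.sum_univ_two]
    rw [if_neg (by decide), if_neg (by decide), if_pos trivial]
    norm_num
  rw [choi_erasureNoise, Matrix.trace_add, Matrix.trace_smul, Matrix.trace_smul,
    Matrix.trace_vecMulVec, dotProduct_comm, star_inclusionVec_dotProduct, h]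
  simp only [smul_eq_mul]
  push_cast
  ring

lemma trace_ptraceSnd_erasureRoot {p : ℝ} (h0 : 0 ≤ p) (h1 : p ≤ 1) :
    (ptraceSnd (erasureRoot p) * ptraceSnd (erasureRoot p)).trace =
      2 * ((2 ^ (erasureStrength p - 1) : ℝ) : ℂ) := by
  set u : ℝ := Real.sqrt ((1 - p) / 2) with hu
  set v : ℝ := Real.sqrt p with hv
  have hlam : 2 * (2 : ℝ) ^ (erasureStrength p - 1) = u * u + u * u + (v + v) * (v + v) := by
    rw [hu, Real.mul_self_sqrt (by linarith), erasureStrength, Real.rpow_sub two_pos,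
      Real.rpow_one, Real.rpow_logb two_pos (by norm_num) (by linarith)]
    have := Real.mul_self_sqrt h0
    linear_combination -4 * this
  -- Tracing out the input qubit counts the erased level twice, hence `v + v`; the squares sum to (1
  -- - p) + 4p = 1 + 3p.
  have hpt : ptraceSnd (erasureRoot p) = Matrix.diagonal ![(u : ℂ), (u : ℂ), (v + v : ℂ)] := by
    ext i j
    fin_cases i <;> fin_cases j <;>
      simp [ptraceSnd, erasureRoot, Fin.sum_univ_two, Matrix.vecMulVec_apply, inclusionVec,
        qubitInclusion, erasedProjection, hu, hv]
  rw [hpt, Matrix.diagonal_mul_diagonal, Matrix.trace_diagonal, Fin.sum_univ_three]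
  simp only [Matrix.cons_val]
  exact_mod_cast hlam.symm

end

end QEC

theorem mainTheorem5 (a b m D : ℕ) (hab : a ≤ b) (hn : Even (b * m)) (hD : 1 ≤ D) :
    (∀ p : Fin 4 → ℝ, (∀ j, 0 ≤ p j) → ∑ j, p j = 1 →
      ∀ (E : Type*) [Fintype E] [DecidableEq E]
        (V : Matrix ((Fin (b * m) → Fin 2) × E) (Fin (b * m) → Fin 2) ℂ),
        QEC.IsStinespring (QEC.tensorPower (b * m) (QEC.pauliNoise p)) V →
        QEC.partitionFunction a b m D V =
          ((3 ^ (a * m) * (2 ^ (b * m) / 3 ^ (b * m)) *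
            QEC.trajectorySum a b m D (2 ^ (QEC.pauliStrength p - 1)) : ℝ) : ℂ)) ∧
    (∀ p : ℝ, 0 ≤ p → p ≤ 1 →
      ∀ (E : Type*) [Fintype E] [DecidableEq E]
        (V : Matrix ((Fin (b * m) → Fin 3) × E) (Fin (b * m) → Fin 2) ℂ),
        QEC.IsStinespring (QEC.tensorPower (b * m) (QEC.erasureNoise p)) V →
        QEC.partitionFunction a b m D V =
          ((3 ^ (a * m) * (2 ^ (b * m) / 3 ^ (b * m)) *
            QEC.trajectorySum a b m D (2 ^ (QEC.erasureStrength p - 1)) : ℝ) : ℂ)) := by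
  refine ⟨fun p hp hp1 E _ _ V hV => ?_, fun p h0 h1 E _ _ V hV => ?_⟩
  · exact QEC.partitionFunction_eq hab hn hD (QEC.pauliRoot_posSemidef p)
      (QEC.pauliRoot_mul_self hp) (QEC.trace_choi_pauliNoise hp1)
      (QEC.trace_ptraceSnd_pauliRoot hp hp1) hV
  · exact QEC.partitionFunction_eq hab hn hD (QEC.erasureRoot_posSemidef p)
      (QEC.erasureRoot_mul_self h0 h1) (QEC.trace_choi_erasureNoise p)
      (QEC.trace_ptraceSnd_erasureRoot h0 h1) hV
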